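/- Let $X$ be a real Banach space with dual $X^*$, let $u, f_j, g_i \colon X \to \mathbb{R}$ ($j \in J = \{1,\dots,l\}$, $i \in I = \{1,\dots,m\}$, where $l, m \ge 0$), and consider the problem $$ \min u(x) \quad \text{subject to} \quad f_j(x) = 0,\ j \in J, \qquad g_i(x) \le 0,\ i \in I. \tag{$\mathcal{P}$} $$ Definitions. A quasidifferential of $f \colon X \to \mathbb{R}$ at $x$ is a pair $\mathscr{D} f(x) = [\underline{\partial} f(x), \overline{\partial} f(x)]$ of nonempty convex weak$^*$ compact subsets of $X^*$ such that for every $h \in X$ the limit $f'(x,h) = \lim_{\alpha \to +0} (f(x + \alpha h) - f(x))/\alpha$ exists and $$ f'(x,h) = \max_{v^* \in \underline{\partial} f(x)} \langle v^*, h\rangle + \min_{w^* \in \overline{\partial} f(x)} \langle w^*, h \rangle ; $$ if such a pair exists, $f$ is called quasidifferentiable at $x$. A quasidifferential mapping $\mathscr{D} f(\cdot)$ defined in a neighbourhood of $\overline{x}$ is outer semicontinuous (o.s.c.) at $\overline{x}$ if for all weak$^*$ open sets $V_1 \supseteq \underline{\partial} f(\overline{x})$ and $V_2 \supseteq \overline{\partial}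 f(\overline{x})$ one has $\underline{\partial} f(x) \subseteq V_1$ and $\overline{\partial} f(x) \subseteq V_2$ for all $x$ sufficiently close to $\overline{x}$ (this holds, in particular, if the condition is satisfied for all norm open $V_1$, $V_2$). Put $[\mathscr{D} f(x)]^+ = \underline{\partial} f(x) + \overline{\partial} f(x)$. For $F = (f_1, \dots, f_l) \colon X \to \mathbb{R}^l$, where $\mathbb{R}^l$ has the Euclidean norm, $y^* = (y_1, \dots, y_l) \in (\mathbb{R}^l)^*$ and $[t]_+ = \max\{t,0\}$, put $$ \underline{\partial} F(x; y^*) = \sum_{j=1}^l \big( [y_j]_+ \underline{\partial} f_j(x) - [-y_j]_+ \overline{\partial} f_j(x) \big), \quad \overline{\partial} F(x; y^*) = \sum_{j=1}^l \big( [y_j]_+ \overline{\partial} f_j(x) - [-y_j]_+ \underline{\partial} f_j(x) \big), $$ and $[\mathscr{D} F(x; y^*)]^+ = \underline{\partial} F(x; y^*) + \overline{\partial} F(x; y^*)$. The constraint qualification q.d.-MFCQ holds at $\overline{x}$ (for the given quasidifferentials of $f_j$ and $g_i$) if $$ \inf_{\|y^*\| = 1} \inf\{ \|v^*\| : v^*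 \in [\mathscr{D} F(\overline{x}; y^*)]^+ \} > 0 \qquad (\inf \emptyset = +\infty), $$ and there is $\overline{h} \in X$ such that $\langle v^*, \overline{h} \rangle = 0$ for all $v^* \in [\mathscr{D} F(\overline{x}; y^*)]^+$ and all $y^*$, while $\langle v^*, \overline{h} \rangle < 0$ for all $v^* \in [\mathscr{D} g_i(\overline{x})]^+$ and all $i$ with $g_i(\overline{x}) = 0$. For $c \ge 0$ let $$ \Psi_c(x) = u(x) + c \Big( \sum_{j=1}^l |f_j(x)| + \sum_{i=1}^m \max\{g_i(x), 0\} \Big). $$ Theorem. Let $\overline{x}$ be a locally optimal solution of $(\mathcal{P})$; let $u$ be Lipschitz continuous near $\overline{x}$ and quasidifferentiable at $\overline{x}$ with a quasidifferential $\mathscr{D} u(\overline{x})$; let $f_j$ and $g_i$ be quasidifferentiable in a neighbourhood of $\overline{x}$ with quasidifferential mappings $\mathscr{D} f_j(\cdot)$, $\mathscr{D} g_i(\cdot)$ that are defined in this neighbourhood and o.s.c. at $\overline{x}$; and let q.d.-MFCQ hold at $\overline{x}$ for these mappings. Then there exists $c^* \ge 0$ such that the following holds. (1) For every $c \ge c^*$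 the function $\Psi_c$ is quasidifferentiable at $\overline{x}$, and for every quasidifferential $[\underline{\partial} \Psi_c(\overline{x}), \overline{\partial} \Psi_c(\overline{x})]$ of $\Psi_c$ at $\overline{x}$ one has $0 \in \underline{\partial} \Psi_c(\overline{x}) + w^*$ for all $w^* \in \overline{\partial} \Psi_c(\overline{x})$. (2) For all $w_0^* \in \overline{\partial} u(\overline{x})$, $v_j^* \in \underline{\partial} f_j(\overline{x})$, $w_j^* \in \overline{\partial} f_j(\overline{x})$, $j \in J$, and $z_i^* \in \overline{\partial} g_i(\overline{x})$, $i \in I$, there exist $\underline{\mu}_j, \overline{\mu}_j, \lambda_i \ge 0$ such that $\lambda_i g_i(\overline{x}) = 0$, $\lambda_i \le c^*$ for all $i \in I$, $\underline{\mu}_j + \overline{\mu}_j \le c^*$ for all $j \in J$, and $$ 0 \in \underline{\partial} u(\overline{x}) + w_0^* - \sum_{j=1}^l \underline{\mu}_j \big( v_j^* + \overline{\partial} f_j(\overline{x}) \big) + \sum_{j=1}^l \overline{\mu}_j \big( \underline{\partial} f_j(\overline{x}) + w_j^* \big) + \sum_{i=1}^m \lambda_i \big( \underline{\partial} g_i(\overline{x})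 + z_i^* \big). $$ -/

import Mathlib

open Set Filter Topology
open scoped Pointwise

namespace Quasidiff

/-- A pair `[sub, super]` of subsets of the dual space `X*`. -/
structure DualPair (X : Type*) [NormedAddCommGroup X] [NormedSpace ℝ X] where
  /-- the first set of the pair (the subdifferential) -/
  sub : Set (StrongDual ℝ X)
  /-- the second set of the pair (the superdifferential) -/
  super : Set (StrongDual ℝ X)

section
variable {X : Type*} [NormedAddCommGroup X] [NormedSpace ℝ X]

/-- A set of functionals, regarded as a subset of `X*` with the weak-star topology. -/
def weakStar (S : Set (StrongDual ℝ X)) : Set (WeakDual ℝ X) :=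
  StrongDual.toWeakDual '' S

/-- The Dini directional derivative of `f` at `x` in the direction `h` exists and equals `L`. -/
def HasDiniDirDerivAt (f : X → ℝ) (x h : X) (L : ℝ) : Prop :=
  Tendsto (fun α : ℝ => (f (x + α • h) - f x) / α) (𝓝[>] 0) (𝓝 L)

/-- `D` is a (Dini) quasidifferential of `f` at `x`: both sets are convex and weak-star compact,
`f` is directionally differentiable at `x`, and
`f'(x, h) = max_{v ∈ D.sub} v h + min_{w ∈ D.super} w h` for all `h`
(in particular both sets are nonempty). -/
def IsQuasidifferentialAt (f : X → ℝ) (x : X) (D : DualPair X) : Prop :=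
  Convex ℝ D.sub ∧ Convex ℝ D.super ∧
  IsCompact (weakStar D.sub) ∧ IsCompact (weakStar D.super) ∧
  ∀ h : X, ∃ a b : ℝ,
    IsGreatest ((fun v : StrongDual ℝ X => v h) '' D.sub) a ∧
    IsLeast ((fun w : StrongDual ℝ X => w h) '' D.super) b ∧
    HasDiniDirDerivAt f x h (a + b)

/-- Outer semicontinuity at `x` of a multifunction with values in `X*` (weak-star topology). -/
def OuterSemicontinuousAt (S : X → Set (StrongDual ℝ X)) (x : X) : Prop :=
  ∀ V : Set (WeakDual ℝ X), IsOpen V → weakStar (S x) ⊆ V →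
    ∀ᶠ x' in 𝓝 x, weakStar (S x') ⊆ V

/-- `D` is a quasidifferential mapping of `f` defined in a neighbourhood of `x` and outer
semicontinuous at `x`. (The values of `D` far from `x` play no role.) -/
def IsOSCQuasidifferentialMapAt (f : X → ℝ) (x : X) (D : X → DualPair X) : Prop :=
  (∀ᶠ x' in 𝓝 x, IsQuasidifferentialAt f x' (D x')) ∧
  OuterSemicontinuousAt (fun x' => (D x').sub) x ∧
  OuterSemicontinuousAt (fun x' => (D x').super) x

/-- The quasidifferential sum `[D]⁺ = D.sub + D.super`. -/
def DualPair.qsum (D : DualPair X) : Set (StrongDual ℝ X) := D.sub + D.super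

/-- The scalar quasidifferential, corresponding to `y ∈ (ℝˡ)*`, of the mapping
`F = (f_1, …, f_l) : X → ℝˡ` that is built from quasidifferentials `D_j` of its components.
Here `y_j = y e_j`; the sets are `∑_j ([y_j]_+ sub_j - [-y_j]_+ super_j)` and
`∑_j ([y_j]_+ super_j - [-y_j]_+ sub_j)`. -/
noncomputable def scalarQuasidifferential {l : ℕ} (D : Fin l → DualPair X)
    (y : StrongDual ℝ (EuclideanSpace ℝ (Fin l))) : DualPair X where
  sub := ∑ j, (max (y (EuclideanSpace.single j 1)) 0 • (D j).sub
    - max (-y (EuclideanSpace.single j 1)) 0 • (D j).super)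
  super := ∑ j, (max (y (EuclideanSpace.single j 1)) 0 • (D j).super
    - max (-y (EuclideanSpace.single j 1)) 0 • (D j).sub)

/-- The Mangasarian-Fromovitz constraint qualification in terms of quasidifferentials at `x`, for a
system `F(x) = 0`, `g_i(x) ≤ 0`, where `F : X → Y`. `DF y` is the scalar quasidifferential of `F`
at `x` corresponding to `y ∈ Y*` and `Dg i` is the quasidifferential of `g_i` at `x`.
The first clause says that the infimum of `‖v‖` over all `v ∈ [DF y]⁺`, `‖y‖ = 1`, is positive
(it is `+∞` if there is no such `y`). -/
def QDMFCQ {Y : Type*} [NormedAddCommGroup Y] [NormedSpace ℝ Y] {m : ℕ}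
    (DF : StrongDual ℝ Y → DualPair X) (g : Fin m → X → ℝ) (Dg : Fin m → DualPair X)
    (x : X) : Prop :=
  (∃ κ : ℝ, 0 < κ ∧ ∀ y : StrongDual ℝ Y, ‖y‖ = 1 → ∀ v ∈ (DF y).qsum, κ ≤ ‖v‖) ∧
  ∃ h : X, (∀ y : StrongDual ℝ Y, ∀ v ∈ (DF y).qsum, v h = 0) ∧
    ∀ i, g i x = 0 → ∀ v ∈ (Dg i).qsum, v h < 0

/-- The feasible region of the problem with constraints `f_j(x) = 0`, `g_i(x) ≤ 0`. -/
def feasibleSet {l m : ℕ} (f : Fin l → X → ℝ) (g : Fin m → X → ℝ) : Set X :=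
  {x | (∀ j, f j x = 0) ∧ ∀ i, g i x ≤ 0}

/-- `x` is a locally optimal solution of: minimize `u` subject to `f_j = 0`, `g_i ≤ 0`. -/
def IsLocallyOptimal {l m : ℕ} (u : X → ℝ) (f : Fin l → X → ℝ) (g : Fin m → X → ℝ)
    (x : X) : Prop :=
  x ∈ feasibleSet f g ∧ IsLocalMinOn u (feasibleSet f g) x

/-- The `ℓ₁` penalty function `Ψ_c = u + c (∑_j |f_j| + ∑_i max {g_i, 0})`. -/
noncomputable def penaltyFun {l m : ℕ} (u : X → ℝ) (f : Fin l → X → ℝ) (g : Fin m → X → ℝ)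
    (c : ℝ) (x : X) : ℝ :=
  u x + c * (∑ j, |f j x| + ∑ i, max (g i x) 0)

end

end Quasidiff

/-!
The penalty function is exact, so that the constrained problem turns into unconstrained minimization
of `Ψ_c` near `xbar`, and both assertions become the statement that the directional derivatives of
`Ψ_c` at `xbar` are nonnegative, read through the Hahn-Banach theorem: a convex weak-star compact set
with nonnegative support function contains zero (`IsWeakStarConvexCompact.zero_mem`).

Exactness (`exists_isLocalMin_penaltyFun`) rests on a linear error bound for the constraint violation
`residual = ‖F‖ + ∑ max (g_i) 0`. By the Ekeland principle (`exists_forall_le_add_dist`) such a bound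
holds as soon as no infeasible point near `xbar` is almost stationary for the residual
(`eventually_exists_zero_of_slope`). The constraint qualification excludes such points
(`exists_slope_bound`): at an almost stationary point the multiplier rule produces a linear
combination of elements of the sums `[D f_j]⁺` and `[D g_i]⁺` that is almost zero, and outer
semicontinuity and weak-star compactness allow passing to a limit at `xbar` along an ultrafilter. In
the limit the direction `h` of the constraint qualification annihilates the equality part, which
forces the inequality multipliers to vanish, and the lower bound `κ` rules out the rest. If `F`
vanishes at the almost stationary points, testing with `h` alone is enough. The continuity that the
Ekeland principle requires is not assumed: outer semicontinuity makes the quasidifferentials locally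
bounded by the uniform boundedness principle, so the constraint functions are Lipschitz near `xbar`
(`IsOSCQuasidifferentialMapAt.eventually_continuousAt`).

For the multiplier rule, `|f_j|` and `max (g_i) 0` are not represented by quasidifferentials of their
own; their directional derivatives are majorized by support functions of sets that depend on the
prescribed elements `v_j`, `w_j`, `z_i` (`IsQuasidifferentialAt.exists_abs_le` and
`IsQuasidifferentialAt.exists_posPart_majorant`), and the elements of these sets have exactly the
form that the rule asks for, with multipliers bounded by the penalty parameter.
-/

namespace Quasidiff

/-! ### Convex weak-star compact sets of functionals -/

section
variable {X : Type*} [NormedAddCommGroup X] [NormedSpace ℝ X]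

/-- Convex weak-star compact sets of functionals; the empty set is allowed. -/
def IsWeakStarConvexCompact (S : Set (StrongDual ℝ X)) : Prop :=
  Convex ℝ S ∧ IsCompact (weakStar S)

namespace IsWeakStarConvexCompact

variable {A B : Set (StrongDual ℝ X)}

theorem singleton (v : StrongDual ℝ X) : IsWeakStarConvexCompact {v} := by
  refine ⟨convex_singleton v, ?_⟩
  simp [weakStar]

theorem add (hA : IsWeakStarConvexCompact A) (hB : IsWeakStarConvexCompact B) :
    IsWeakStarConvexCompact (A + B) := by
  refine ⟨hA.1.add hB.1, ?_⟩
  rw [weakStar, Set.image_add]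
  exact hA.2.add hB.2

theorem smul (c : ℝ) (hA : IsWeakStarConvexCompact A) : IsWeakStarConvexCompact (c • A) := by
  refine ⟨hA.1.smul c, ?_⟩
  have : weakStar (c • A) = (fun v : WeakDual ℝ X => c • v) '' weakStar A := by
    simp only [weakStar, image_image, ← image_smul, map_smul]
  rw [this]
  exact hA.2.image (continuous_const_smul c)

theorem neg (hA : IsWeakStarConvexCompact A) : IsWeakStarConvexCompact (-A) := by
  have h : -A = (-1 : ℝ) • A := by
    rw [← image_neg_eq_neg, ← image_smul]
    exact image_congr fun v _ => (neg_one_smul ℝ v).symm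
  rw [h]
  exact hA.smul (-1)

theorem sum {ι : Type*} (s : Finset ι) {A : ι → Set (StrongDual ℝ X)}
    (hA : ∀ i, IsWeakStarConvexCompact (A i)) : IsWeakStarConvexCompact (∑ i ∈ s, A i) := by
  classical
  induction s using Finset.induction_on with
  | empty => rw [Finset.sum_empty]; exact singleton 0
  | insert i s hi ih => rw [Finset.sum_insert hi]; exact (hA i).add ih

theorem convexJoin (hA : IsWeakStarConvexCompact A) (hB : IsWeakStarConvexCompact B) :
    IsWeakStarConvexCompact (convexJoin ℝ A B) := by
  refine ⟨hA.1.convexJoin hB.1, ?_⟩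
  have : weakStar (_root_.convexJoin ℝ A B) =
      (fun p : (WeakDual ℝ X × WeakDual ℝ X) × ℝ => (1 - p.2) • p.1.1 + p.2 • p.1.2) ''
        ((weakStar A ×ˢ weakStar B) ×ˢ Icc (0 : ℝ) 1) := by
    ext v
    simp only [weakStar, mem_image, mem_convexJoin, segment_eq_image, Prod.exists, mem_prod]
    constructor
    · rintro ⟨_, ⟨a, ha, b, hb, t, ht, rfl⟩, rfl⟩
      exact ⟨_, _, t, ⟨⟨⟨a, ha, rfl⟩, ⟨b, hb, rfl⟩⟩, ht⟩, by simp⟩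
    · rintro ⟨_, _, t, ⟨⟨⟨a, ha, rfl⟩, ⟨b, hb, rfl⟩⟩, ht⟩, rfl⟩
      exact ⟨_, ⟨a, ha, b, hb, t, ht, rfl⟩, by simp⟩
  rw [this]
  refine ((hA.2.prod hB.2).prod isCompact_Icc).image ?_
  fun_prop

theorem closedBall (r : ℝ) :
    IsWeakStarConvexCompact (Metric.closedBall (0 : StrongDual ℝ X) r) := by
  refine ⟨convex_closedBall 0 r, ?_⟩
  have : weakStar (Metric.closedBall (0 : StrongDual ℝ X) r) =
      WeakDual.toStrongDual ⁻¹' Metric.closedBall 0 r := by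
    ext v
    constructor
    · rintro ⟨w, hw, rfl⟩; exact hw
    · intro hv; exact ⟨WeakDual.toStrongDual v, hv, rfl⟩
  rw [this]
  exact WeakDual.isCompact_closedBall 0 r

/-- The separation argument behind all multiplier rules: if the support function of a convex
weak-star compact set is nonnegative, then the set contains zero. -/
theorem zero_mem (hA : IsWeakStarConvexCompact A) (h : ∀ x : X, ∃ v ∈ A, 0 ≤ v x) :
    (0 : StrongDual ℝ X) ∈ A := by
  by_contra h0
  have h0' : (0 : WeakDual ℝ X) ∉ weakStar A := by
    rintro ⟨v, hv, hv0⟩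
    rw [LinearEquiv.map_eq_zero_iff] at hv0
    exact h0 (hv0 ▸ hv)
  have hconv : Convex ℝ (weakStar A) :=
    hA.1.linear_image (StrongDual.toWeakDual : StrongDual ℝ X ≃ₗ[ℝ] WeakDual ℝ X).toLinearMap
  have : LocallyConvexSpace ℝ (WeakDual ℝ X) :=
    WeakBilin.locallyConvexSpace (B := topDualPairing ℝ X)
  obtain ⟨F, r, hF, hr⟩ := geometric_hahn_banach_closed_point hconv hA.2.isClosed h0'
  rw [map_zero] at hr
  obtain ⟨x, hx⟩ := LinearMap.dualEmbedding_surjective (topDualPairing ℝ X) F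
  obtain ⟨v, hv, hvx⟩ := h x
  have h1 : F (StrongDual.toWeakDual v) = v x := by rw [← hx]; rfl
  have := hF _ (mem_image_of_mem _ hv)
  linarith

end IsWeakStarConvexCompact

end

/-! ### Dini directional derivatives -/

section
variable {X : Type*} [NormedAddCommGroup X] [NormedSpace ℝ X]

namespace HasDiniDirDerivAt

variable {f g : X → ℝ} {x h : X} {L M : ℝ}

theorem hasDerivWithinAt_iff :
    HasDiniDirDerivAt f x h L ↔ HasDerivWithinAt (fun α : ℝ => f (x + α • h)) L (Ioi 0) 0 := by
  rw [hasDerivWithinAt_iff_tendsto_slope' (by simp), HasDiniDirDerivAt]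
  refine tendsto_congr fun α => ?_
  simp [slope_def_field]

theorem unique (h₁ : HasDiniDirDerivAt f x h L) (h₂ : HasDiniDirDerivAt f x h M) : L = M :=
  tendsto_nhds_unique h₁ h₂

theorem add (h₁ : HasDiniDirDerivAt f x h L) (h₂ : HasDiniDirDerivAt g x h M) :
    HasDiniDirDerivAt (fun y => f y + g y) x h (L + M) := by
  refine (Tendsto.add h₁ h₂).congr fun α => ?_
  ring

theorem neg (h₁ : HasDiniDirDerivAt f x h L) : HasDiniDirDerivAt (fun y => -f y) x h (-L) := by
  refine (Tendsto.neg h₁).congr fun α => ?_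
  ring

theorem const_mul (c : ℝ) (h₁ : HasDiniDirDerivAt f x h L) :
    HasDiniDirDerivAt (fun y => c * f y) x h (c * L) := by
  refine (Tendsto.const_mul c h₁).congr fun α => ?_
  ring

theorem sum {ι : Type*} (s : Finset ι) {f : ι → X → ℝ} {L : ι → ℝ}
    (hf : ∀ i, HasDiniDirDerivAt (f i) x h (L i)) :
    HasDiniDirDerivAt (fun y => ∑ i ∈ s, f i y) x h (∑ i ∈ s, L i) := by
  refine (tendsto_finsetSum s fun i _ => hf i).congr fun α => ?_
  rw [← Finset.sum_div, Finset.sum_sub_distrib]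

theorem congr_of_eventuallyEq (h₁ : HasDiniDirDerivAt f x h L) (hx : f x = g x)
    (hfg : ∀ᶠ α : ℝ in 𝓝[>] 0, f (x + α • h) = g (x + α • h)) : HasDiniDirDerivAt g x h L := by
  refine Tendsto.congr' ?_ h₁
  filter_upwards [hfg] with α hα
  rw [hα, hx]

theorem tendsto_apply (h₁ : HasDiniDirDerivAt f x h L) :
    Tendsto (fun α : ℝ => f (x + α • h)) (𝓝[>] 0) (𝓝 (f x)) := by
  simpa [ContinuousWithinAt] using (hasDerivWithinAt_iff.1 h₁).continuousWithinAt

theorem abs_of_eq_zero (h₁ : HasDiniDirDerivAt f x h L) (hx : f x = 0) :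
    HasDiniDirDerivAt (fun y => |f y|) x h |L| := by
  refine (Tendsto.abs h₁).congr' ?_
  filter_upwards [self_mem_nhdsWithin] with α hα
  rw [hx, abs_div, abs_of_pos (mem_Ioi.1 hα)]
  simp

theorem posPart_of_eq_zero (h₁ : HasDiniDirDerivAt f x h L) (hx : f x = 0) :
    HasDiniDirDerivAt (fun y => max (f y) 0) x h (max L 0) := by
  refine (Tendsto.max h₁ tendsto_const_nhds).congr' ?_
  filter_upwards [self_mem_nhdsWithin] with α hα
  rw [hx, max_self, sub_zero, sub_zero, ← max_div_div_right (le_of_lt hα), zero_div]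

theorem posPart_of_pos (h₁ : HasDiniDirDerivAt f x h L) (hx : 0 < f x) :
    HasDiniDirDerivAt (fun y => max (f y) 0) x h L := by
  refine h₁.congr_of_eventuallyEq (by simp [hx.le]) ?_
  filter_upwards [h₁.tendsto_apply.eventually_const_lt hx] with α hα
  rw [max_eq_left hα.le]

theorem posPart_of_neg (h₁ : HasDiniDirDerivAt f x h L) (hx : f x < 0) :
    HasDiniDirDerivAt (fun y => max (f y) 0) x h 0 := by
  have h0 : HasDiniDirDerivAt (fun _ : X => (0 : ℝ)) x h 0 := by
    simp [HasDiniDirDerivAt]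
  refine h0.congr_of_eventuallyEq (by simp [hx.le]) ?_
  filter_upwards [h₁.tendsto_apply.eventually_lt_const hx] with α hα
  rw [max_eq_right hα.le]

/-- The directional derivative of the Euclidean norm of a vector function, away from its zeros. -/
theorem sqrt_sum_sq {ι : Type*} [Fintype ι] {f : ι → X → ℝ} {L : ι → ℝ}
    (hf : ∀ i, HasDiniDirDerivAt (f i) x h (L i)) (hx : 0 < √(∑ i, f i x ^ 2)) :
    HasDiniDirDerivAt (fun y => √(∑ i, f i y ^ 2)) x h
      (∑ i, f i x / √(∑ i, f i x ^ 2) * L i) := by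
  rw [hasDerivWithinAt_iff]
  have h1 : HasDerivWithinAt (fun α : ℝ => ∑ i, f i (x + α • h) ^ 2)
      (∑ i, 2 * f i x * L i) (Ioi 0) 0 := by
    refine HasDerivWithinAt.fun_sum fun i _ => ?_
    simpa using (hasDerivWithinAt_iff.1 (hf i)).fun_pow 2
  convert! h1.sqrt (by simpa using (Real.sqrt_pos.1 hx).ne') using 1
  simp only [zero_smul, add_zero, Finset.sum_div]
  refine Finset.sum_congr rfl fun i _ => ?_
  field_simp

/-- A lower bound for the growth of `f` at `x` bounds its directional derivatives from below. -/
theorem neg_mul_norm_le {a : ℝ} (h₁ : HasDiniDirDerivAt f x h L)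
    (hmin : ∀ᶠ y in 𝓝 x, f x ≤ f y + a * ‖y - x‖) : -(a * ‖h‖) ≤ L := by
  have hc : Tendsto (fun α : ℝ => x + α • h) (𝓝[>] 0) (𝓝 x) := by
    have : Continuous fun α : ℝ => x + α • h := by fun_prop
    simpa using (this.tendsto 0).mono_left nhdsWithin_le_nhds
  refine ge_of_tendsto h₁ ?_
  filter_upwards [hc.eventually hmin, self_mem_nhdsWithin] with α hα hpos
  have hpos : (0 : ℝ) < α := hpos
  rw [le_div_iff₀ hpos]
  rw [add_sub_cancel_left, norm_smul, Real.norm_of_nonneg hpos.le] at hα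
  linarith

end HasDiniDirDerivAt

end

/-! ### Calculus of quasidifferentials -/

section
variable {X : Type*} [NormedAddCommGroup X] [NormedSpace ℝ X]

section Extrema

variable {A B : Set (StrongDual ℝ X)} {h : X} {a b : ℝ}

theorem isGreatest_apply_add (ha : IsGreatest ((fun v : StrongDual ℝ X => v h) '' A) a)
    (hb : IsGreatest ((fun v : StrongDual ℝ X => v h) '' B) b) :
    IsGreatest ((fun v : StrongDual ℝ X => v h) '' (A + B)) (a + b) := by
  obtain ⟨⟨v, hv, rfl⟩, hA⟩ := ha
  obtain ⟨⟨w, hw, rfl⟩, hB⟩ := hb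
  refine ⟨⟨v + w, add_mem_add hv hw, rfl⟩, ?_⟩
  rintro _ ⟨_, ⟨v', hv', w', hw', rfl⟩, rfl⟩
  exact add_le_add (hA (mem_image_of_mem _ hv')) (hB (mem_image_of_mem _ hw'))

theorem isGreatest_apply_neg (hb : IsLeast ((fun v : StrongDual ℝ X => v h) '' B) b) :
    IsGreatest ((fun v : StrongDual ℝ X => v h) '' (-B)) (-b) := by
  obtain ⟨⟨w, hw, rfl⟩, hB⟩ := hb
  refine ⟨⟨-w, neg_mem_neg.2 hw, rfl⟩, ?_⟩
  rintro _ ⟨w', hw', rfl⟩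
  have := hB (mem_image_of_mem _ hw')
  simp only [neg_apply] at this
  exact le_neg_of_le_neg this

theorem isLeast_apply_neg (ha : IsGreatest ((fun v : StrongDual ℝ X => v h) '' A) a) :
    IsLeast ((fun v : StrongDual ℝ X => v h) '' (-A)) (-a) := by
  obtain ⟨⟨w, hw, rfl⟩, hA⟩ := ha
  refine ⟨⟨-w, neg_mem_neg.2 hw, rfl⟩, ?_⟩
  rintro _ ⟨w', hw', rfl⟩
  have := hA (mem_image_of_mem _ hw')
  simp only [neg_apply] at this
  exact neg_le.1 this

theorem isLeast_apply_add (ha : IsLeast ((fun v : StrongDual ℝ X => v h) '' A) a)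
    (hb : IsLeast ((fun v : StrongDual ℝ X => v h) '' B) b) :
    IsLeast ((fun v : StrongDual ℝ X => v h) '' (A + B)) (a + b) := by
  obtain ⟨⟨v, hv, rfl⟩, hA⟩ := ha
  obtain ⟨⟨w, hw, rfl⟩, hB⟩ := hb
  refine ⟨⟨v + w, add_mem_add hv hw, rfl⟩, ?_⟩
  rintro _ ⟨_, ⟨v', hv', w', hw', rfl⟩, rfl⟩
  exact add_le_add (hA (mem_image_of_mem _ hv')) (hB (mem_image_of_mem _ hw'))

theorem isGreatest_apply_smul {c : ℝ} (hc : 0 ≤ c)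
    (ha : IsGreatest ((fun v : StrongDual ℝ X => v h) '' A) a) :
    IsGreatest ((fun v : StrongDual ℝ X => v h) '' (c • A)) (c * a) := by
  obtain ⟨⟨v, hv, rfl⟩, hA⟩ := ha
  refine ⟨⟨c • v, smul_mem_smul_set hv, rfl⟩, ?_⟩
  rintro _ ⟨_, ⟨v', hv', rfl⟩, rfl⟩
  exact mul_le_mul_of_nonneg_left (hA (mem_image_of_mem _ hv')) hc

theorem isLeast_apply_smul {c : ℝ} (hc : 0 ≤ c)
    (ha : IsLeast ((fun v : StrongDual ℝ X => v h) '' A) a) :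
    IsLeast ((fun v : StrongDual ℝ X => v h) '' (c • A)) (c * a) := by
  obtain ⟨⟨v, hv, rfl⟩, hA⟩ := ha
  refine ⟨⟨c • v, smul_mem_smul_set hv, rfl⟩, ?_⟩
  rintro _ ⟨_, ⟨v', hv', rfl⟩, rfl⟩
  exact mul_le_mul_of_nonneg_left (hA (mem_image_of_mem _ hv')) hc

theorem isGreatest_apply_convexJoin (ha : IsGreatest ((fun v : StrongDual ℝ X => v h) '' A) a)
    (hb : IsGreatest ((fun v : StrongDual ℝ X => v h) '' B) b) :
    IsGreatest ((fun v : StrongDual ℝ X => v h) '' (convexJoin ℝ A B)) (max a b) := by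
  obtain ⟨⟨v, hv, rfl⟩, hA⟩ := ha
  obtain ⟨⟨w, hw, rfl⟩, hB⟩ := hb
  refine ⟨?_, ?_⟩
  · rcases max_choice (v h) (w h) with H | H
    · exact ⟨v, subset_convexJoin_left ⟨w, hw⟩ hv, H.symm⟩
    · exact ⟨w, subset_convexJoin_right ⟨v, hv⟩ hw, H.symm⟩
  · rintro _ ⟨u, hu, rfl⟩
    obtain ⟨v', hv', w', hw', s, t, hs, ht, hst, rfl⟩ := mem_convexJoin.1 hu
    have h1 : v' h ≤ max (v h) (w h) := (hA (mem_image_of_mem _ hv')).trans (le_max_left _ _)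
    have h2 : w' h ≤ max (v h) (w h) := (hB (mem_image_of_mem _ hw')).trans (le_max_right _ _)
    calc s * v' h + t * w' h ≤ s * max (v h) (w h) + t * max (v h) (w h) := by gcongr
      _ = max (v h) (w h) := by rw [← add_mul, hst, one_mul]

end Extrema

namespace IsQuasidifferentialAt

variable {f g : X → ℝ} {x : X} {D E : DualPair X}

theorem sub_convexCompact (hD : IsQuasidifferentialAt f x D) : IsWeakStarConvexCompact D.sub :=
  ⟨hD.1, hD.2.2.1⟩

theorem super_convexCompact (hD : IsQuasidifferentialAt f x D) :
    IsWeakStarConvexCompact D.super :=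
  ⟨hD.2.1, hD.2.2.2.1⟩

theorem mk_of_convexCompact (h₁ : IsWeakStarConvexCompact D.sub)
    (h₂ : IsWeakStarConvexCompact D.super)
    (h : ∀ h : X, ∃ a b : ℝ,
      IsGreatest ((fun v : StrongDual ℝ X => v h) '' D.sub) a ∧
      IsLeast ((fun w : StrongDual ℝ X => w h) '' D.super) b ∧
      HasDiniDirDerivAt f x h (a + b)) : IsQuasidifferentialAt f x D :=
  ⟨h₁.1, h₂.1, h₁.2, h₂.2, h⟩

theorem sub_nonempty (hD : IsQuasidifferentialAt f x D) : D.sub.Nonempty := by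
  obtain ⟨a, b, ha, -⟩ := hD.2.2.2.2 0
  exact ha.nonempty.of_image

theorem super_nonempty (hD : IsQuasidifferentialAt f x D) : D.super.Nonempty := by
  obtain ⟨a, b, -, hb, -⟩ := hD.2.2.2.2 0
  exact hb.nonempty.of_image

/-- The directional derivative, with functionals at which the maximum and the minimum in the
quasidifferential formula are attained. -/
theorem exists_extremal (hD : IsQuasidifferentialAt f x D) (h : X) :
    ∃ v ∈ D.sub, ∃ w ∈ D.super, (∀ v' ∈ D.sub, v' h ≤ v h) ∧ (∀ w' ∈ D.super, w h ≤ w' h) ∧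
      HasDiniDirDerivAt f x h (v h + w h) := by
  obtain ⟨a, b, ⟨⟨v, hv, rfl⟩, ha⟩, ⟨⟨w, hw, rfl⟩, hb⟩, hL⟩ := hD.2.2.2.2 h
  exact ⟨v, hv, w, hw, fun v' hv' => ha (mem_image_of_mem _ hv'),
    fun w' hw' => hb (mem_image_of_mem _ hw'), hL⟩

theorem add (hf : IsQuasidifferentialAt f x D) (hg : IsQuasidifferentialAt g x E) :
    IsQuasidifferentialAt (fun y => f y + g y) x ⟨D.sub + E.sub, D.super + E.super⟩ := by
  refine mk_of_convexCompact (hf.sub_convexCompact.add hg.sub_convexCompact)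
    (hf.super_convexCompact.add hg.super_convexCompact) fun h => ?_
  obtain ⟨a, b, ha, hb, hab⟩ := hf.2.2.2.2 h
  obtain ⟨c, d, hc, hd, hcd⟩ := hg.2.2.2.2 h
  refine ⟨a + c, b + d, isGreatest_apply_add ha hc, isLeast_apply_add hb hd, ?_⟩
  rw [add_add_add_comm]
  exact hab.add hcd

theorem neg (hf : IsQuasidifferentialAt f x D) :
    IsQuasidifferentialAt (fun y => -f y) x ⟨-D.super, -D.sub⟩ := by
  refine mk_of_convexCompact hf.super_convexCompact.neg hf.sub_convexCompact.neg fun h => ?_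
  obtain ⟨a, b, ha, hb, hab⟩ := hf.2.2.2.2 h
  refine ⟨-b, -a, isGreatest_apply_neg hb, isLeast_apply_neg ha, ?_⟩
  rw [← neg_add_rev]
  exact hab.neg

theorem const_mul {c : ℝ} (hc : 0 ≤ c) (hf : IsQuasidifferentialAt f x D) :
    IsQuasidifferentialAt (fun y => c * f y) x ⟨c • D.sub, c • D.super⟩ := by
  refine mk_of_convexCompact (hf.sub_convexCompact.smul c) (hf.super_convexCompact.smul c)
    fun h => ?_
  obtain ⟨a, b, ha, hb, hab⟩ := hf.2.2.2.2 h
  refine ⟨c * a, c * b, isGreatest_apply_smul hc ha, isLeast_apply_smul hc hb, ?_⟩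
  rw [← mul_add]
  exact hab.const_mul c

/-- A function whose directional derivatives at `x` all vanish has quasidifferential `[{0}, {0}]`
at `x`. -/
theorem of_hasDiniDirDerivAt_zero (hf : ∀ h, HasDiniDirDerivAt f x h 0) :
    IsQuasidifferentialAt f x ⟨{0}, {0}⟩ := by
  refine mk_of_convexCompact (.singleton 0) (.singleton 0) fun h => ⟨0, 0, ?_, ?_, ?_⟩
  · simp
  · simp
  · simpa using hf h

theorem exists_sum {ι : Type*} (s : Finset ι) {f : ι → X → ℝ}
    (hf : ∀ i, ∃ D, IsQuasidifferentialAt (f i) x D) :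
    ∃ D, IsQuasidifferentialAt (fun y => ∑ i ∈ s, f i y) x D := by
  classical
  induction s using Finset.induction_on with
  | empty => exact ⟨_, of_hasDiniDirDerivAt_zero fun h => by simp [HasDiniDirDerivAt]⟩
  | insert i s hi ih =>
    obtain ⟨D, hD⟩ := hf i
    obtain ⟨E, hE⟩ := ih
    simp only [Finset.sum_insert hi]
    exact ⟨_, hD.add hE⟩

/-- With `p = max D.sub` and `q = max (-D.super)`, the derivative of `max f 0` at a zero of `f` is
`max (p - q) 0 = max p q - q`. -/
theorem posPart_of_eq_zero (hf : IsQuasidifferentialAt f x D) (hx : f x = 0) :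
    IsQuasidifferentialAt (fun y => max (f y) 0) x ⟨convexJoin ℝ D.sub (-D.super), D.super⟩ := by
  refine mk_of_convexCompact (hf.sub_convexCompact.convexJoin hf.super_convexCompact.neg)
    hf.super_convexCompact fun h => ?_
  obtain ⟨a, b, ha, hb, hab⟩ := hf.2.2.2.2 h
  refine ⟨max a (-b), b, isGreatest_apply_convexJoin ha (isGreatest_apply_neg hb), hb, ?_⟩
  rw [max_add, neg_add_cancel]
  exact hab.posPart_of_eq_zero hx

theorem exists_posPart_of_nonpos (hf : IsQuasidifferentialAt f x D) (hx : f x ≤ 0) :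
    ∃ E, IsQuasidifferentialAt (fun y => max (f y) 0) x E := by
  rcases hx.lt_or_eq with hx | hx
  · refine ⟨_, of_hasDiniDirDerivAt_zero fun h => ?_⟩
    obtain ⟨v, -, w, -, -, -, hL⟩ := hf.exists_extremal h
    exact hL.posPart_of_neg hx
  · exact ⟨_, hf.posPart_of_eq_zero hx⟩

theorem exists_abs_of_eq_zero (hf : IsQuasidifferentialAt f x D) (hx : f x = 0) :
    ∃ E, IsQuasidifferentialAt (fun y => |f y|) x E := by
  have h := (hf.posPart_of_eq_zero hx).add (hf.neg.posPart_of_eq_zero (by simp [hx]))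
  simp only [max_zero_add_max_neg_zero_eq_abs_self] at h
  exact ⟨_, h⟩

/-- A multiple of the directional derivative is majorized by the support function of a convex
weak-star compact set of multiples of elements of `D.sub + D.super`. The sign of `y` decides which
of the two extremal terms is frozen at an arbitrary element. -/
theorem exists_smul_majorant (hD : IsQuasidifferentialAt f x D) (y : ℝ) :
    ∃ A, IsWeakStarConvexCompact A ∧ (∀ c ∈ A, ∃ e ∈ D.qsum, c = y • e) ∧
      ∀ h L, HasDiniDirDerivAt f x h L → ∃ c ∈ A, y * L ≤ c h := by
  obtain ⟨v₀, hv₀⟩ := hD.sub_nonempty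
  obtain ⟨w₀, hw₀⟩ := hD.super_nonempty
  rcases le_total 0 y with hy | hy
  · refine ⟨y • (D.sub + {w₀}), (hD.sub_convexCompact.add (.singleton w₀)).smul y, ?_, ?_⟩
    · rintro _ ⟨_, ⟨v, hv, _, rfl, rfl⟩, rfl⟩
      exact ⟨_, add_mem_add hv hw₀, rfl⟩
    · intro h L hL
      obtain ⟨v, hv, w, hw, -, hmin, hL'⟩ := hD.exists_extremal h
      refine ⟨y • (v + w₀), smul_mem_smul_set (add_mem_add hv rfl), ?_⟩
      rw [hL.unique hL']
      exact mul_le_mul_of_nonneg_left (add_le_add le_rfl (hmin _ hw₀)) hy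
  · refine ⟨y • ({v₀} + D.super), ((IsWeakStarConvexCompact.singleton v₀).add
      hD.super_convexCompact).smul y, ?_, ?_⟩
    · rintro _ ⟨_, ⟨_, rfl, w, hw, rfl⟩, rfl⟩
      exact ⟨_, add_mem_add hv₀ hw, rfl⟩
    · intro h L hL
      obtain ⟨v, hv, w, hw, hmax, -, hL'⟩ := hD.exists_extremal h
      refine ⟨y • (v₀ + w), smul_mem_smul_set (add_mem_add rfl hw), ?_⟩
      rw [hL.unique hL']
      exact mul_le_mul_of_nonpos_left (add_le_add (hmax _ hv₀) le_rfl) hy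

/-- The modulus of the directional derivative is majorized by the support function of the convex
hull of `D.sub + w` and `-(v + D.super)`, for every choice of `v ∈ D.sub` and `w ∈ D.super`. -/
theorem exists_abs_le (hD : IsQuasidifferentialAt f x D) {v w : StrongDual ℝ X}
    (hv : v ∈ D.sub) (hw : w ∈ D.super) {h : X} {L : ℝ} (hL : HasDiniDirDerivAt f x h L) :
    ∃ c ∈ convexJoin ℝ (D.sub + {w}) (-({v} + D.super)), |L| ≤ c h := by
  obtain ⟨v', hv', w', hw', hmax, hmin, hL'⟩ := hD.exists_extremal h
  rw [hL.unique hL']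
  have h₁ : v' + w ∈ D.sub + {w} := add_mem_add hv' rfl
  have h₂ : -(v + w') ∈ -({v} + D.super) := neg_mem_neg.2 (add_mem_add rfl hw')
  rcases abs_choice (v' h + w' h) with H | H
  · refine ⟨_, subset_convexJoin_left ⟨_, h₂⟩ h₁, ?_⟩
    rw [H]
    exact add_le_add le_rfl (hmin _ hw)
  · refine ⟨_, subset_convexJoin_right ⟨_, h₁⟩ h₂, ?_⟩
    rw [H]
    exact neg_le_neg (add_le_add (hmax _ hv) le_rfl)

/-- The directional derivative of `max f 0` is majorized by the support function of a convex
weak-star compact set of elements `t • (a + z)`, `a ∈ D.sub`, with the sign conditions on `t` that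
make it a multiplier. -/
theorem exists_posPart_majorant (hD : IsQuasidifferentialAt f x D) {z : StrongDual ℝ X}
    (hz : z ∈ D.super) :
    ∃ G, IsWeakStarConvexCompact G ∧
      (∀ c ∈ G, ∃ t : ℝ, ∃ a ∈ D.sub, 0 ≤ t ∧ t ≤ 1 ∧ (0 < f x → t = 1) ∧ (f x < 0 → t = 0) ∧
        c = t • (a + z)) ∧
      ∀ h, ∃ L, HasDiniDirDerivAt (fun y => max (f y) 0) x h L ∧ ∃ c ∈ G, L ≤ c h := by
  have hK : IsWeakStarConvexCompact (D.sub + {z}) := hD.sub_convexCompact.add (.singleton z)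
  have hmem : ∀ h L, HasDiniDirDerivAt f x h L → ∃ c ∈ D.sub + {z}, L ≤ c h := by
    intro h L hL
    obtain ⟨v, hv, w, hw, -, hmin, hL'⟩ := hD.exists_extremal h
    exact ⟨v + z, add_mem_add hv rfl, hL.unique hL' ▸ add_le_add le_rfl (hmin _ hz)⟩
  have hex : ∀ h, ∃ L, HasDiniDirDerivAt f x h L := fun h => by
    obtain ⟨v, -, w, -, -, -, hL'⟩ := hD.exists_extremal h
    exact ⟨_, hL'⟩
  rcases lt_trichotomy (f x) 0 with hx | hx | hx
  · obtain ⟨a, ha⟩ := hD.sub_nonempty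
    refine ⟨{0}, .singleton 0, ?_, fun h => ?_⟩
    · rintro _ rfl
      exact ⟨0, a, ha, le_rfl, zero_le_one, fun h => absurd h hx.not_gt, fun _ => rfl, by simp⟩
    · obtain ⟨L, hL⟩ := hex h
      exact ⟨0, hL.posPart_of_neg hx, 0, rfl, le_rfl⟩
  · refine ⟨convexJoin ℝ {0} (D.sub + {z}), (IsWeakStarConvexCompact.singleton 0).convexJoin hK,
      ?_, fun h => ?_⟩
    · intro c hc
      obtain ⟨_, rfl, _, ⟨a, ha, _, rfl, rfl⟩, s, t, hs, ht, hst, rfl⟩ := mem_convexJoin.1 hc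
      exact ⟨t, a, ha, ht, by linarith, fun h => absurd hx h.ne', fun h => absurd hx h.ne,
        by simp⟩
    · obtain ⟨L, hL⟩ := hex h
      obtain ⟨c, hc, hLc⟩ := hmem h L hL
      refine ⟨max L 0, hL.posPart_of_eq_zero hx, ?_⟩
      rcases max_choice L 0 with H | H
      · exact ⟨c, subset_convexJoin_right (singleton_nonempty 0) hc, by rwa [H]⟩
      · exact ⟨0, subset_convexJoin_left ⟨c, hc⟩ rfl, by rw [H]; rfl⟩
  · refine ⟨D.sub + {z}, hK, ?_, fun h => ?_⟩
    · rintro _ ⟨a, ha, _, rfl, rfl⟩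
      exact ⟨1, a, ha, zero_le_one, le_rfl, fun _ => rfl, fun h => absurd h hx.not_gt, by simp⟩
    · obtain ⟨L, hL⟩ := hex h
      exact ⟨L, hL.posPart_of_pos hx, hmem h L hL⟩

end IsQuasidifferentialAt

end

/-! ### Outer semicontinuous quasidifferential mappings -/

section
variable {X : Type*} [NormedAddCommGroup X] [NormedSpace ℝ X]

variable {ι : Type*} {xbar : X}

/-- Along an ultrafilter, a selection of an outer semicontinuous multifunction with weak-star
compact value at `xbar` converges pointwise to an element of that value. -/
theorem OuterSemicontinuousAt.exists_tendsto {S : X → Set (StrongDual ℝ X)}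
    (hS : OuterSemicontinuousAt S xbar) (hc : IsCompact (weakStar (S xbar))) (𝒰 : Ultrafilter ι)
    {x : ι → X} (hx : Tendsto x 𝒰 (𝓝 xbar)) {s : ι → StrongDual ℝ X}
    (hs : ∀ i, s i ∈ S (x i)) :
    ∃ v ∈ S xbar, ∀ h, Tendsto (fun i => s i h) 𝒰 (𝓝 (v h)) := by
  by_contra! hcon
  -- Every point of the compact set has a neighbourhood that the ultrafilter avoids.
  have key : ∀ v ∈ weakStar (S xbar), ∃ V : Set (WeakDual ℝ X), IsOpen V ∧ v ∈ V ∧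
      ∀ᶠ i in (𝒰 : Filter ι), StrongDual.toWeakDual (s i) ∉ V := by
    rintro _ ⟨v, hv, rfl⟩
    obtain ⟨h, hh⟩ := hcon v hv
    obtain ⟨O, hO, hsO⟩ := not_tendsto_iff_exists_frequently_notMem.1 hh
    obtain ⟨O', hO'O, hO', hvO'⟩ := mem_nhds_iff.1 hO
    refine ⟨(fun w : WeakDual ℝ X => w h) ⁻¹' O', hO'.preimage (WeakDual.eval_continuous h),
      hvO', ?_⟩
    refine (Ultrafilter.frequently_iff_eventually.1 hsO).mono fun i hi hi' => hi (hO'O hi')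
  choose! V hVo hVv hV using key
  obtain ⟨t, ht⟩ := hc.elim_nhds_subcover' (fun v _ => V v)
    fun v hv => (hVo v hv).mem_nhds (hVv v hv)
  have hsub := hx.eventually (hS _ (isOpen_biUnion fun v (_ : v ∈ t) => hVo v v.2) ht)
  have hnot : ∀ᶠ i in (𝒰 : Filter ι), ∀ v ∈ t, StrongDual.toWeakDual (s i) ∉ V v :=
    (Filter.eventually_all_finset t).2 fun v _ => hV v v.2
  obtain ⟨i, hi, hi'⟩ := (hsub.and hnot).exists
  obtain ⟨v, hv, hiv⟩ := mem_iUnion₂.1 (hi (mem_image_of_mem _ (hs i)))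
  exact hi' v hv hiv

/-- An outer semicontinuous multifunction with weak-star compact value at `xbar` is norm bounded
near `xbar`. Weak-star open sets may be unbounded, so this rests on the uniform boundedness
principle. -/
theorem OuterSemicontinuousAt.exists_norm_le [CompleteSpace X] {S : X → Set (StrongDual ℝ X)}
    (hS : OuterSemicontinuousAt S xbar) (hc : IsCompact (weakStar (S xbar))) :
    ∃ M : ℝ, ∀ᶠ x in 𝓝 xbar, ∀ v ∈ S x, ‖v‖ ≤ M := by
  by_contra! hcon
  have hch : ∀ n : ℕ, ∃ x ∈ Metric.ball xbar (1 / ((n : ℝ) + 1)), ∃ v ∈ S x, (n : ℝ) < ‖v‖ := by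
    intro n
    have := (hcon n).and_eventually
      (Metric.ball_mem_nhds xbar (Nat.one_div_pos_of_nat : 0 < 1 / ((n : ℝ) + 1)))
    obtain ⟨x, ⟨v, hv, hn⟩, hx⟩ := this.exists
    exact ⟨x, hx, v, hv, hn⟩
  choose x hx v hv hn using hch
  have hlim : Tendsto x atTop (𝓝 xbar) := by
    rw [tendsto_iff_dist_tendsto_zero]
    exact squeeze_zero (fun n => dist_nonneg) (fun n => (Metric.mem_ball.1 (hx n)).le)
      tendsto_one_div_add_atTop_nhds_zero_nat
  obtain ⟨C, hC⟩ := banach_steinhaus (g := v) fun h => by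
    obtain ⟨R, hR⟩ := (hc.image (WeakDual.eval_continuous h)).isBounded.exists_norm_le
    have hev := hS ((fun w : WeakDual ℝ X => w h) ⁻¹' Metric.ball 0 (R + 1))
      (Metric.isOpen_ball.preimage (WeakDual.eval_continuous h)) fun w hw => by
        have := hR _ (mem_image_of_mem _ hw)
        simpa using this.trans_lt (lt_add_one R)
    have hb : ∀ᶠ n in atTop, ‖v n h‖ ≤ R + 1 := by
      filter_upwards [hlim.eventually hev] with n hsub
      have := hsub (mem_image_of_mem _ (hv n))
      simpa using (Metric.mem_ball.1 this).le
    obtain ⟨N, hN⟩ := eventually_atTop.1 hb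
    refine ⟨max (R + 1) (∑ k ∈ Finset.range N, ‖v k h‖), fun n => ?_⟩
    rcases lt_or_ge n N with h1 | h1
    · exact le_max_of_le_right (Finset.single_le_sum (f := fun k => ‖v k h‖)
        (fun _ _ => norm_nonneg _) (Finset.mem_range.2 h1))
    · exact le_max_of_le_left (hN n h1)
  obtain ⟨n, hn'⟩ := exists_nat_gt C
  exact (hn'.trans (hn n)).not_ge (hC n)

/-- A function with right derivatives along every segment of a convex set, bounded by `M` times the
length of the direction, is Lipschitz on that set. The reversed direction gives continuity from the
left, which the one-sided mean value inequality needs. -/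
theorem norm_sub_le_of_dini_le {f : X → ℝ} {U : Set X} (hU : Convex ℝ U) {M : ℝ}
    (hf : ∀ x ∈ U, ∀ h, ∃ L, HasDiniDirDerivAt f x h L ∧ |L| ≤ M * ‖h‖) {x y : X} (hx : x ∈ U)
    (hy : y ∈ U) : ‖f y - f x‖ ≤ M * ‖y - x‖ := by
  set d := y - x with hd
  have hmem : ∀ t ∈ Icc (0 : ℝ) 1, x + t • d ∈ U := fun t ht => hU.add_smul_sub_mem hx hy ht
  choose! L hL hLM using hf
  have hderiv : ∀ t ∈ Icc (0 : ℝ) 1,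
      HasDerivWithinAt (fun s : ℝ => f (x + s • d)) (L (x + t • d) d) (Ici t) t := by
    intro t ht
    have h1 := HasDiniDirDerivAt.hasDerivWithinAt_iff.1 (hL _ (hmem t ht) d)
    rw [hasDerivWithinAt_Ioi_iff_Ici] at h1
    have h2 : HasDerivWithinAt (fun s : ℝ => s - t) 1 (Ici t) t :=
      (hasDerivWithinAt_id t _).sub_const t
    have h3 := HasDerivWithinAt.comp_of_eq t h1 h2 (fun s hs => by simpa using hs) (sub_self t).symm
    rw [mul_one] at h3
    refine h3.congr_of_mem (fun s _ => ?_) self_mem_Ici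
    simp only [Function.comp, sub_smul]
    congr 1
    abel
  have hleft : ∀ t ∈ Icc (0 : ℝ) 1,
      ContinuousWithinAt (fun s : ℝ => f (x + s • d)) (Iic t) t := by
    intro t ht
    have h1 := HasDiniDirDerivAt.hasDerivWithinAt_iff.1 (hL _ (hmem t ht) (-d))
    rw [hasDerivWithinAt_Ioi_iff_Ici] at h1
    have h2 : ContinuousWithinAt (fun s : ℝ => t - s) (Iic t) t := by fun_prop
    have h3 := ContinuousWithinAt.comp_of_eq h1.continuousWithinAt h2
      (fun s hs => by simpa using hs) (sub_self t)
    refine h3.congr_of_mem (fun s _ => ?_) self_mem_Iic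
    simp only [Function.comp, sub_smul, smul_neg]
    congr 1
    abel
  have hcont : ContinuousOn (fun s : ℝ => f (x + s • d)) (Icc 0 1) := by
    intro t ht
    refine (continuousAt_iff_continuous_left_right.2 ?_).continuousWithinAt
    exact ⟨hleft t ht, (hderiv t ht).continuousWithinAt⟩
  have := norm_image_sub_le_of_norm_deriv_right_le_segment hcont
    (fun t ht => hderiv t (Ico_subset_Icc_self ht))
    (fun t ht => hLM _ (hmem t (Ico_subset_Icc_self ht)) d) 1 (right_mem_Icc.2 zero_le_one)
  simpa [hd] using this

theorem IsOSCQuasidifferentialMapAt.isQuasidifferentialAt {f : X → ℝ} {D : X → DualPair X}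
    (hD : IsOSCQuasidifferentialMapAt f xbar D) : IsQuasidifferentialAt f xbar (D xbar) :=
  hD.1.self_of_nhds

theorem IsOSCQuasidifferentialMapAt.eventually_continuousAt [CompleteSpace X] {f : X → ℝ}
    {D : X → DualPair X} (hD : IsOSCQuasidifferentialMapAt f xbar D) :
    ∀ᶠ x in 𝓝 xbar, ContinuousAt f x := by
  obtain ⟨hq, h₁, h₂⟩ := hD
  obtain ⟨M₁, hM₁⟩ := h₁.exists_norm_le hq.self_of_nhds.sub_convexCompact.2
  obtain ⟨M₂, hM₂⟩ := h₂.exists_norm_le hq.self_of_nhds.super_convexCompact.2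
  obtain ⟨r, hr, hball⟩ := Metric.eventually_nhds_iff_ball.1 (hq.and (hM₁.and hM₂))
  have hlip : ∀ x ∈ Metric.ball xbar r, ∀ y ∈ Metric.ball xbar r,
      ‖f y - f x‖ ≤ (M₁ + M₂) * ‖y - x‖ := by
    intro x hx y hy
    refine norm_sub_le_of_dini_le (convex_ball xbar r) (fun z hz h => ?_) hx hy
    obtain ⟨hz, hz₁, hz₂⟩ := hball z hz
    obtain ⟨v, hv, w, hw, -, -, hL⟩ := hz.exists_extremal h
    refine ⟨_, hL, (abs_add_le _ _).trans ?_⟩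
    rw [add_mul]
    exact add_le_add ((v.le_of_opNorm_le (hz₁ v hv) h)) (w.le_of_opNorm_le (hz₂ w hw) h)
  filter_upwards [Metric.ball_mem_nhds xbar hr] with x hx
  have h0 : Tendsto (fun y => (M₁ + M₂) * ‖y - x‖) (𝓝 x) (𝓝 0) := by
    have : Continuous fun y => (M₁ + M₂) * ‖y - x‖ := by fun_prop
    simpa using this.tendsto x
  rw [ContinuousAt, tendsto_iff_norm_sub_tendsto_zero]
  refine squeeze_zero' (.of_forall fun y => norm_nonneg _) ?_ h0
  filter_upwards [Metric.isOpen_ball.mem_nhds hx] with y hy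
  exact hlip x hx y hy

/-- The limit of a selection of the quasidifferential sums, along an ultrafilter. -/
theorem IsOSCQuasidifferentialMapAt.exists_tendsto_qsum {f : X → ℝ} {D : X → DualPair X}
    (hD : IsOSCQuasidifferentialMapAt f xbar D) (𝒰 : Ultrafilter ι) {x : ι → X}
    (hx : Tendsto x 𝒰 (𝓝 xbar)) {s : ι → StrongDual ℝ X} (hs : ∀ i, s i ∈ (D (x i)).qsum) :
    ∃ v ∈ (D xbar).qsum, ∀ h, Tendsto (fun i => s i h) 𝒰 (𝓝 (v h)) := by
  choose a ha b hb hab using hs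
  obtain ⟨v, hv, hav⟩ := hD.2.1.exists_tendsto
    hD.isQuasidifferentialAt.sub_convexCompact.2 𝒰 hx ha
  obtain ⟨w, hw, hbw⟩ := hD.2.2.exists_tendsto
    hD.isQuasidifferentialAt.super_convexCompact.2 𝒰 hx hb
  refine ⟨v + w, add_mem_add hv hw, fun h => ?_⟩
  refine ((hav h).add (hbw h)).congr fun i => ?_
  rw [← hab i]
  rfl

end

/-! ### The Ekeland principle and linear error bounds -/

section

/-- A form of the Ekeland variational principle for nonnegative continuous functions. -/
theorem exists_forall_le_add_dist {α : Type*} [MetricSpace α] [CompleteSpace α] {φ : α → ℝ}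
    (hφ : Continuous φ) (h0 : ∀ x, 0 ≤ φ x) {a : ℝ} (ha : 0 < a) (x₀ : α) :
    ∃ x, φ x + a * dist x₀ x ≤ φ x₀ ∧ ∀ y, φ x ≤ φ y + a * dist x y := by
  let S : α → Set α := fun x => {y | φ y + a * dist x y ≤ φ x}
  have hself : ∀ x, x ∈ S x := fun x => by simp [S]
  have htrans : ∀ {x y z}, y ∈ S x → z ∈ S y → z ∈ S x := by
    intro x y z hy hz
    have hy : φ y + a * dist x y ≤ φ x := hy
    have hz : φ z + a * dist y z ≤ φ y := hz
    have := mul_le_mul_of_nonneg_left (dist_triangle x y z) ha.le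
    change φ z + a * dist x z ≤ φ x
    linarith
  -- Each step at least halves the distance of `φ` to its infimum over the section `S x`.
  have hnext : ∀ x, ∃ y ∈ S x, ∀ z ∈ S x, 2 * φ y - φ x ≤ φ z := by
    intro x
    have hbdd : BddBelow (φ '' S x) := ⟨0, by rintro _ ⟨y, -, rfl⟩; exact h0 y⟩
    rcases (csInf_le hbdd (mem_image_of_mem φ (hself x))).lt_or_eq with hlt | heq
    · obtain ⟨_, ⟨y, hy, rfl⟩, hyl⟩ := exists_lt_of_csInf_lt (Set.Nonempty.image φ ⟨x, hself x⟩)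
        (show sInf (φ '' S x) < (φ x + sInf (φ '' S x)) / 2 by linarith)
      refine ⟨y, hy, fun z hz => ?_⟩
      have := csInf_le hbdd (mem_image_of_mem φ hz)
      linarith
    · refine ⟨x, hself x, fun z hz => ?_⟩
      have := csInf_le hbdd (mem_image_of_mem φ hz)
      linarith
  choose next hnS hnext using hnext
  let x : ℕ → α := fun n => next^[n] x₀
  have hsucc : ∀ n, x (n + 1) = next (x n) := fun n => Function.iterate_succ_apply' next n x₀
  have hchain : ∀ n k, x (n + k) ∈ S (x n) := by
    intro n k
    induction k with
    | zero => exact hself _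
    | succ k ih => exact htrans ih (by rw [← add_assoc, hsucc]; exact hnS _)
  have hle : ∀ n k, n ≤ k → φ (x k) + a * dist (x n) (x k) ≤ φ (x n) := by
    intro n k hnk
    obtain ⟨j, rfl⟩ := Nat.exists_eq_add_of_le hnk
    exact hchain n j
  have hanti : Antitone fun n => φ (x n) := fun n k hnk => by
    have := hle n k hnk
    have := mul_nonneg ha.le (dist_nonneg (x := x n) (y := x k))
    simp only
    linarith
  have hlim := tendsto_atTop_ciInf hanti ⟨0, by rintro _ ⟨n, rfl⟩; exact h0 _⟩
  set m := ⨅ n, φ (x n)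
  have hcauchy : CauchySeq x := by
    refine cauchySeq_of_le_tendsto_0' (fun n => (φ (x n) - m) / a) (fun n k hnk => ?_) ?_
    · rw [le_div_iff₀ ha]
      have h1 := hle n k hnk
      have h2 : m ≤ φ (x k) := hanti.le_of_tendsto hlim k
      linarith
    · simpa using (hlim.sub_const m).div_const a
  obtain ⟨z, hz⟩ := cauchySeq_tendsto_of_complete hcauchy
  have hφz : φ z = m := tendsto_nhds_unique ((hφ.tendsto z).comp hz) hlim
  have hzS : ∀ n, z ∈ S (x n) := by
    intro n
    refine le_of_tendsto (((hφ.tendsto z).comp hz).add ((tendsto_const_nhds.dist hz).const_mul a))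
      ?_
    filter_upwards [eventually_ge_atTop n] with k hk using hle n k hk
  refine ⟨z, hzS 0, fun y => ?_⟩
  by_contra! hy
  have hyS : y ∈ S z := hy.le
  have hlow : m ≤ φ y := by
    have h1 : Tendsto (fun n => 2 * φ (x (n + 1)) - φ (x n)) atTop (𝓝 (2 * m - m)) :=
      ((hlim.comp (tendsto_add_atTop_nat 1)).const_mul 2).sub hlim
    have h2 := le_of_tendsto h1 (.of_forall fun n => by
      rw [hsucc]
      exact hnext (x n) y (htrans (hzS n) hyS))
    linarith
  have := mul_nonneg ha.le (dist_nonneg (x := z) (y := y))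
  linarith

/-- A function that is not `a`-stationary at any nearby point where it is positive has a linear
error bound: its zeros are within distance `φ x / a` of `x`. -/
theorem eventually_exists_zero_of_slope {X : Type*} [NormedAddCommGroup X] [CompleteSpace X]
    {φ : X → ℝ} {xbar : X} (h0 : ∀ x, 0 ≤ φ x) (hx : φ xbar = 0)
    (hc : ∀ᶠ x in 𝓝 xbar, ContinuousAt φ x) {a : ℝ} (ha : 0 < a)
    (hslope : ∀ᶠ x in 𝓝 xbar, 0 < φ x → ¬ ∀ᶠ y in 𝓝 x, φ x ≤ φ y + a * ‖y - x‖)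
    {U : Set X} (hU : U ∈ 𝓝 xbar) :
    ∀ᶠ x in 𝓝 xbar, ∃ z ∈ U, φ z = 0 ∧ a * ‖x - z‖ ≤ φ x := by
  obtain ⟨r, hr, hball⟩ := Metric.nhds_basis_closedBall.eventually_iff.1
    ((hc.and hslope).and (eventually_mem_set.2 hU))
  have hφx : ∀ᶠ x in 𝓝 xbar, φ x < a * (r / 2) := by
    have hlim : Tendsto φ (𝓝 xbar) (𝓝 0) := by
      have := hc.self_of_nhds
      rwa [ContinuousAt, hx] at this
    exact hlim.eventually_lt_const (by positivity)
  filter_upwards [Metric.ball_mem_nhds xbar (half_pos hr), hφx] with x hxr hxφ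
  have hxB : x ∈ Metric.closedBall xbar r :=
    Metric.ball_subset_closedBall (Metric.ball_subset_ball (half_le_self hr.le) hxr)
  have : CompleteSpace (Metric.closedBall xbar r) :=
    Metric.isClosed_closedBall.isComplete.completeSpace_coe
  have hcont : Continuous fun z : Metric.closedBall xbar r => φ z :=
    continuous_iff_continuousAt.2 fun z =>
      ContinuousAt.comp (hball z.2).1.1 continuous_subtype_val.continuousAt
  obtain ⟨⟨z, hzB⟩, hz, hmin⟩ :=
    exists_forall_le_add_dist hcont (fun z => h0 z) ha ⟨x, hxB⟩
  simp only [Subtype.dist_eq] at hz hmin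
  have hz' : a * ‖x - z‖ ≤ φ x := by
    rw [← dist_eq_norm]
    linarith [h0 z]
  refine ⟨z, (hball hzB).2, ?_, hz'⟩
  by_contra hne
  -- The Ekeland point is interior to the ball, so its stationarity contradicts the slope bound.
  have hint : z ∈ Metric.ball xbar r := by
    rw [← dist_eq_norm] at hz'
    have h1 : dist x z < r / 2 := lt_of_mul_lt_mul_left (hz'.trans_lt hxφ) ha.le
    have h2 := dist_triangle_left z xbar x
    have h3 := Metric.mem_ball.1 hxr
    exact Metric.mem_ball.2 (by linarith)
  refine (hball hzB).1.2 ((h0 z).lt_of_ne' hne) ?_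
  filter_upwards [Metric.isOpen_ball.mem_nhds hint] with y hy
  have := hmin ⟨y, Metric.ball_subset_closedBall hy⟩
  rwa [dist_comm, dist_eq_norm] at this

end

/-! ### Almost stationary points of the constraint violation -/

section
variable {X : Type*} {l m : ℕ}

/-- The constraint violation. The equality constraints enter through their Euclidean norm, which is
directionally differentiable away from its zeros with a unit vector of multipliers; constraints that
happen to vanish get the multiplier zero. -/
noncomputable def residual (f : Fin l → X → ℝ) (g : Fin m → X → ℝ) (x : X) : ℝ :=
  √(∑ j, f j x ^ 2) + ∑ i, max (g i x) 0

theorem residual_nonneg (f : Fin l → X → ℝ) (g : Fin m → X → ℝ) (x : X) : 0 ≤ residual f g x :=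
  add_nonneg (Real.sqrt_nonneg _) (Finset.sum_nonneg fun _ _ => le_max_right _ _)

theorem residual_eq_zero_iff {f : Fin l → X → ℝ} {g : Fin m → X → ℝ} {x : X} :
    residual f g x = 0 ↔ x ∈ feasibleSet f g := by
  rw [residual, add_eq_zero_iff_of_nonneg (Real.sqrt_nonneg _)
    (Finset.sum_nonneg fun _ _ => le_max_right _ _),
    Real.sqrt_eq_zero (Finset.sum_nonneg fun _ _ => sq_nonneg _),
    Finset.sum_eq_zero_iff_of_nonneg fun _ _ => sq_nonneg _,
    Finset.sum_eq_zero_iff_of_nonneg fun _ _ => le_max_right _ _]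
  simp [feasibleSet]

theorem sqrt_sum_sq_le_sum_abs (y : Fin l → ℝ) : √(∑ j, y j ^ 2) ≤ ∑ j, |y j| := by
  rw [Real.sqrt_le_left (Finset.sum_nonneg fun _ _ => abs_nonneg _)]
  simp only [← sq_abs (y _)]
  exact Finset.sum_sq_le_sq_sum_of_nonneg fun _ _ => abs_nonneg _

end

section
variable {X : Type*} [NormedAddCommGroup X] [NormedSpace ℝ X] {l m : ℕ}

/-- The multiplier rule at an almost stationary point of the residual at which the equality
constraints are violated. -/
theorem exists_multipliers_of_sqrt_pos {f : Fin l → X → ℝ} {g : Fin m → X → ℝ} {x : X}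
    {D : Fin l → DualPair X} {E : Fin m → DualPair X}
    (hD : ∀ j, IsQuasidifferentialAt (f j) x (D j))
    (hE : ∀ i, IsQuasidifferentialAt (g i) x (E i)) {a : ℝ} (ha : 0 ≤ a)
    (hstat : ∀ᶠ y in 𝓝 x, residual f g x ≤ residual f g y + a * ‖y - x‖)
    (hpos : 0 < √(∑ j, f j x ^ 2)) :
    ∃ (y : EuclideanSpace ℝ (Fin l)) (e : Fin l → StrongDual ℝ X) (t : Fin m → ℝ)
      (ζ : Fin m → StrongDual ℝ X), ‖y‖ = 1 ∧ (∀ j, e j ∈ (D j).qsum) ∧ (∀ i, t i ∈ Icc 0 1) ∧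
      (∀ i, ζ i ∈ (E i).qsum) ∧ (∀ i, g i x < 0 → t i = 0) ∧
      ∀ h, |∑ j, y j * e j h + ∑ i, t i * ζ i h| ≤ a * ‖h‖ := by
  set N := √(∑ j, f j x ^ 2) with hN
  choose A hAcc hAmem hA using fun j => (hD j).exists_smul_majorant (f j x / N)
  choose z hz using fun i => (hE i).super_nonempty
  choose G hGcc hGmem hG using fun i => (hE i).exists_posPart_majorant (hz i)
  have h0 : (0 : StrongDual ℝ X) ∈ Metric.closedBall 0 a + (∑ j, A j + ∑ i, G i) := by
    refine IsWeakStarConvexCompact.zero_mem ((IsWeakStarConvexCompact.closedBall a).add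
      ((IsWeakStarConvexCompact.sum _ hAcc).add (IsWeakStarConvexCompact.sum _ hGcc))) fun h => ?_
    choose v hv w hw _ _ hL using fun j => (hD j).exists_extremal h
    choose c hc hLc using fun j => hA j h _ (hL j)
    choose L' hL' c' hc' hLc' using fun i => hG i h
    obtain ⟨p, hp, hph⟩ := exists_dual_vector'' ℝ h
    refine ⟨a • p + (∑ j, c j + ∑ i, c' i), add_mem_add ?_ (add_mem_add
      (finsetSum_mem_finsetSum _ _ _ fun j _ => hc j)
      (finsetSum_mem_finsetSum _ _ _ fun i _ => hc' i)), ?_⟩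
    · rw [mem_closedBall_zero_iff, norm_smul, Real.norm_of_nonneg ha]
      exact mul_le_of_le_one_right ha hp
    · have hlow := HasDiniDirDerivAt.neg_mul_norm_le
        ((HasDiniDirDerivAt.sqrt_sum_sq hL hpos).add (HasDiniDirDerivAt.sum Finset.univ hL')) hstat
      have h1 : ∑ j, f j x / N * (v j h + w j h) ≤ ∑ j, c j h := Finset.sum_le_sum fun j _ => hLc j
      have h2 : ∑ i, L' i ≤ ∑ i, c' i h := Finset.sum_le_sum fun i _ => hLc' i
      simp only [add_apply, smul_apply, sum_apply, hph, smul_eq_mul,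
        RCLike.ofReal_real_eq_id, id]
      linarith
  obtain ⟨p, hp, _, ⟨_, hcA, _, hcG, rfl⟩, hsum⟩ := h0
  obtain ⟨c, hc, rfl⟩ := (mem_fintype_sum _ _).1 hcA
  obtain ⟨c', hc', rfl⟩ := (mem_fintype_sum _ _).1 hcG
  choose e he hce using fun j => hAmem j (c j) (hc j)
  choose t α hα ht0 ht1 _ htneg hcα using fun i => hGmem i (c' i) (hc' i)
  refine ⟨WithLp.toLp 2 fun j => f j x / N, e, t, fun i => α i + z i, ?_, he,
    fun i => ⟨ht0 i, ht1 i⟩, fun i => add_mem_add (hα i) (hz i), htneg, fun h => ?_⟩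
  · have hN2 : N ^ 2 = ∑ j, f j x ^ 2 :=
      Real.sq_sqrt (Finset.sum_nonneg fun _ _ => sq_nonneg _)
    rw [EuclideanSpace.norm_eq]
    simp only [Real.norm_eq_abs, sq_abs, div_pow, ← Finset.sum_div]
    rw [← hN2, div_self (by positivity), Real.sqrt_one]
  · have h1 : p h + (∑ j, f j x / N * e j h + ∑ i, t i * (α i + z i) h) = 0 := by
      have := congrArg (fun v : StrongDual ℝ X => v h) hsum
      simpa [hce, hcα, mul_add] using this
    have h2 : |p h| ≤ a * ‖h‖ := p.le_of_opNorm_le (mem_closedBall_zero_iff.1 hp) h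
    rwa [← neg_eq_of_add_eq_zero_right h1, abs_neg]

/-- The substitute for the multiplier rule at an almost stationary point of the residual at which
only inequality constraints are violated: testing with one direction suffices. -/
theorem exists_multipliers_of_sqrt_eq_zero {f : Fin l → X → ℝ} {g : Fin m → X → ℝ} {x : X}
    {D : Fin l → DualPair X} {E : Fin m → DualPair X}
    (hD : ∀ j, IsQuasidifferentialAt (f j) x (D j))
    (hE : ∀ i, IsQuasidifferentialAt (g i) x (E i)) {a : ℝ}
    (hstat : ∀ᶠ y in 𝓝 x, residual f g x ≤ residual f g y + a * ‖y - x‖)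
    (hpos : 0 < residual f g x) (hzero : √(∑ j, f j x ^ 2) = 0) (h : X) :
    ∃ (e : Fin l → StrongDual ℝ X) (t : Fin m → ℝ)
      (ζ : Fin m → StrongDual ℝ X), (∀ j, e j ∈ (D j).qsum) ∧ (∀ i, t i ∈ Icc 0 1) ∧
      (∀ i, ζ i ∈ (E i).qsum) ∧ (∀ i, g i x < 0 → t i = 0) ∧ 1 ≤ ∑ i, t i ∧
      -(a * ‖h‖) ≤ ∑ j, |e j h| + ∑ i, t i * ζ i h := by
  choose v hv w hw _ _ hL using fun j => (hD j).exists_extremal h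
  choose z hz using fun i => (hE i).super_nonempty
  choose G hGcc hGmem hG using fun i => (hE i).exists_posPart_majorant (hz i)
  choose L' hL' c' hc' hLc' using fun i => hG i h
  choose t α hα ht0 ht1 htpos htneg hcα using fun i => hGmem i (c' i) (hc' i)
  have hf0 : ∀ j, f j x = 0 := by
    rw [Real.sqrt_eq_zero (Finset.sum_nonneg fun _ _ => sq_nonneg _),
      Finset.sum_eq_zero_iff_of_nonneg fun _ _ => sq_nonneg _] at hzero
    simpa using hzero
  refine ⟨fun j => v j + w j, t, fun i => α i + z i, fun j => add_mem_add (hv j) (hw j),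
    fun i => ⟨ht0 i, ht1 i⟩, fun i => add_mem_add (hα i) (hz i), htneg, ?_, ?_⟩
  · rw [residual, hzero, zero_add] at hpos
    obtain ⟨i, -, hi⟩ := Finset.exists_lt_of_sum_lt (s := Finset.univ) (f := fun _ => (0 : ℝ))
      (g := fun i => max (g i x) 0) (by simpa using hpos)
    have hgi : 0 < g i x := by simpa using hi
    rw [← htpos i hgi]
    exact Finset.single_le_sum (fun i _ => ht0 i) (Finset.mem_univ i)
  · -- The `ℓ₁` norm majorizes the Euclidean norm and agrees with it at `x`.
    have hstat' : ∀ᶠ y in 𝓝 x, ∑ j, |f j x| + ∑ i, max (g i x) 0 ≤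
        (∑ j, |f j y| + ∑ i, max (g i y) 0) + a * ‖y - x‖ := by
      filter_upwards [hstat] with y hy
      simp only [residual, hzero] at hy
      have := sqrt_sum_sq_le_sum_abs fun j => f j y
      simp only [hf0, abs_zero, Finset.sum_const_zero]
      linarith
    have hlow := HasDiniDirDerivAt.neg_mul_norm_le ((HasDiniDirDerivAt.sum Finset.univ
      fun j => (hL j).abs_of_eq_zero (hf0 j)).add (HasDiniDirDerivAt.sum Finset.univ hL')) hstat'
    refine hlow.trans (add_le_add le_rfl (Finset.sum_le_sum fun i _ => ?_))
    have := hLc' i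
    rw [hcα] at this
    exact this

/-- Linear combinations of elements of the sums `[D_j]⁺` belong to the corresponding scalar
quasidifferential sum. -/
theorem sum_smul_mem_qsum_scalarQuasidifferential {D : Fin l → DualPair X}
    {e : Fin l → StrongDual ℝ X} (he : ∀ j, e j ∈ (D j).qsum)
    (y : StrongDual ℝ (EuclideanSpace ℝ (Fin l))) :
    ∑ j, y (EuclideanSpace.single j 1) • e j ∈ (scalarQuasidifferential D y).qsum := by
  choose a ha b hb hab using he
  have key : ∑ j, y (EuclideanSpace.single j 1) • e j =
      ∑ j, (max (y (EuclideanSpace.single j 1)) 0 • a j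
          - max (-y (EuclideanSpace.single j 1)) 0 • b j)
        + ∑ j, (max (y (EuclideanSpace.single j 1)) 0 • b j
          - max (-y (EuclideanSpace.single j 1)) 0 • a j) := by
    rw [← Finset.sum_add_distrib]
    refine Finset.sum_congr rfl fun j _ => ?_
    have h1 := max_zero_sub_max_neg_zero_eq_self (y (EuclideanSpace.single j 1))
    rw [← hab j]
    conv_lhs => rw [← h1]
    simp only
    module
  rw [key]
  simp only [DualPair.qsum, scalarQuasidifferential]
  refine add_mem_add ?_ ?_
  · exact finsetSum_mem_finsetSum _ _ _ fun j _ =>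
      Set.sub_mem_sub (smul_mem_smul_set (ha j)) (smul_mem_smul_set (hb j))
  · exact finsetSum_mem_finsetSum _ _ _ fun j _ =>
      Set.sub_mem_sub (smul_mem_smul_set (hb j)) (smul_mem_smul_set (ha j))

/-- Under the constraint qualification no nearby infeasible point is almost stationary for the
residual. Otherwise, the multipliers at a sequence of almost stationary points would have, along an
ultrafilter, a nontrivial limit at `xbar`; testing with the direction from the constraint
qualification shows that the inequality multipliers vanish in the limit, and then the equality
multipliers contradict the uniform lower bound. -/
theorem exists_slope_bound [CompleteSpace X] {f : Fin l → X → ℝ} {g : Fin m → X → ℝ} {xbar : X}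
    (hfeas : xbar ∈ feasibleSet f g)
    {Df : Fin l → X → DualPair X} (hDf : ∀ j, IsOSCQuasidifferentialMapAt (f j) xbar (Df j))
    {Dg : Fin m → X → DualPair X} (hDg : ∀ i, IsOSCQuasidifferentialMapAt (g i) xbar (Dg i))
    (hMFCQ : QDMFCQ (scalarQuasidifferential fun j => Df j xbar) g (fun i => Dg i xbar) xbar) :
    ∃ a : ℝ, 0 < a ∧ ∀ᶠ x in 𝓝 xbar, 0 < residual f g x →
      ¬ ∀ᶠ y in 𝓝 x, residual f g x ≤ residual f g y + a * ‖y - x‖ := by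
  obtain ⟨⟨κ, hκ, hκle⟩, hbar, hbarf, hbarg⟩ := hMFCQ
  by_contra! hcon
  have hq : ∀ᶠ x in 𝓝 xbar, (∀ j, IsQuasidifferentialAt (f j) x (Df j x)) ∧
      (∀ i, IsQuasidifferentialAt (g i) x (Dg i x)) ∧ ∀ i, g i xbar < 0 → g i x < 0 := by
    refine (eventually_all.2 fun j => (hDf j).1).and
      ((eventually_all.2 fun i => (hDg i).1).and (eventually_all.2 fun i => ?_))
    by_cases hi : g i xbar < 0
    · have hcont : ContinuousAt (g i) xbar := (hDg i).eventually_continuousAt.self_of_nhds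
      filter_upwards [hcont.eventually_lt_const hi] with x hx _ using hx
    · exact .of_forall fun x h => absurd h hi
  have hseq : ∀ n : ℕ, ∃ x ∈ Metric.ball xbar (1 / ((n : ℝ) + 1)), ∃ (y : EuclideanSpace ℝ (Fin l))
      (e : Fin l → StrongDual ℝ X) (t : Fin m → ℝ) (ζ : Fin m → StrongDual ℝ X),
      ‖y‖ ≤ 1 ∧ (∀ j, e j ∈ (Df j x).qsum) ∧ (∀ i, t i ∈ Icc (0 : ℝ) 1) ∧
      (∀ i, ζ i ∈ (Dg i x).qsum) ∧ (∀ i, g i xbar < 0 → t i = 0) ∧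
      -(1 / ((n : ℝ) + 1) * ‖hbar‖) ≤ ∑ j, |e j hbar| + ∑ i, t i * ζ i hbar ∧
      (1 ≤ ∑ i, t i ∨ ‖y‖ = 1 ∧
        ∀ h, |∑ j, y j * e j h + ∑ i, t i * ζ i h| ≤ 1 / ((n : ℝ) + 1) * ‖h‖) := by
    intro n
    have hn : 0 < 1 / ((n : ℝ) + 1) := Nat.one_div_pos_of_nat
    obtain ⟨x, ⟨hpos, hstat⟩, hx, hD, hE, hneg⟩ :=
      ((hcon _ hn).and_eventually ((eventually_mem_set.2 (Metric.ball_mem_nhds xbar hn)).and hq)).exists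
    refine ⟨x, hx, ?_⟩
    rcases (Real.sqrt_nonneg (∑ j, f j x ^ 2)).eq_or_lt' with hN | hN
    · obtain ⟨e, t, ζ, he, ht, hζ, hneg', hsum, hle⟩ :=
        exists_multipliers_of_sqrt_eq_zero hD hE hstat hpos hN hbar
      exact ⟨0, e, t, ζ, by simp, he, ht, hζ, fun i hi => hneg' i (hneg i hi), hle, .inl hsum⟩
    · obtain ⟨y, e, t, ζ, hy, he, ht, hζ, hneg', hle⟩ :=
        exists_multipliers_of_sqrt_pos hD hE hn.le hstat hN
      refine ⟨y, e, t, ζ, hy.le, he, ht, hζ, fun i hi => hneg' i (hneg i hi), ?_, .inr ⟨hy, hle⟩⟩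
      have h1 : ∑ j, y j * e j hbar ≤ ∑ j, |e j hbar| := by
        refine Finset.sum_le_sum fun j _ => (le_abs_self _).trans ?_
        rw [abs_mul]
        exact mul_le_of_le_one_left (abs_nonneg _) ((PiLp.norm_apply_le y j).trans hy.le)
      linarith [(abs_le.1 (hle hbar)).1]
  choose x hx y e t ζ hy he ht hζ hneg hlow hcase using hseq
  set 𝒰 : Ultrafilter ℕ := hyperfilter ℕ with h𝒰
  have h𝒰le : (𝒰 : Filter ℕ) ≤ atTop := Nat.hyperfilter_le_atTop
  have hε : Tendsto (fun n : ℕ => 1 / ((n : ℝ) + 1)) 𝒰 (𝓝 0) :=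
    tendsto_one_div_add_atTop_nhds_zero_nat.mono_left h𝒰le
  have hxlim : Tendsto x 𝒰 (𝓝 xbar) := by
    rw [tendsto_iff_dist_tendsto_zero]
    exact squeeze_zero (fun n => dist_nonneg) (fun n => (Metric.mem_ball.1 (hx n)).le) hε
  choose e₀ he₀ helim using fun j =>
    (hDf j).exists_tendsto_qsum 𝒰 hxlim (s := fun n => e n j) fun n => he n j
  choose ζ₀ hζ₀ hζlim using fun i =>
    (hDg i).exists_tendsto_qsum 𝒰 hxlim (s := fun n => ζ n i) fun n => hζ n i
  have htex : ∀ i, ∃ s ∈ Icc (0 : ℝ) 1, Tendsto (fun n => t n i) 𝒰 (𝓝 s) := fun i =>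
    isCompact_Icc.ultrafilter_le_nhds (𝒰.map fun n => t n i)
      (le_principal_iff.2 (Eventually.of_forall (f := (𝒰 : Filter ℕ)) fun n => ht n i))
  choose t₀ ht₀ htlim using htex
  obtain ⟨y₀, -, hylim⟩ : ∃ y₀ ∈ Metric.closedBall (0 : EuclideanSpace ℝ (Fin l)) 1,
      Tendsto y 𝒰 (𝓝 y₀) :=
    (isCompact_closedBall _ _).ultrafilter_le_nhds (𝒰.map y) (le_principal_iff.2
      (Eventually.of_forall (f := (𝒰 : Filter ℕ)) fun n => mem_closedBall_zero_iff.2 (hy n)))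
  -- Vectors of `ℝˡ` act as functionals through the inner product.
  have hqsum : ∀ y' : EuclideanSpace ℝ (Fin l), ∃ φ : StrongDual ℝ (EuclideanSpace ℝ (Fin l)),
      ‖φ‖ = ‖y'‖ ∧
      ∑ j, y' j • e₀ j ∈ (scalarQuasidifferential (fun j => Df j xbar) φ).qsum := by
    intro y'
    refine ⟨innerSL ℝ y', innerSL_apply_norm ℝ y', ?_⟩
    simpa [EuclideanSpace.inner_single_right] using sum_smul_mem_qsum_scalarQuasidifferential he₀ (innerSL ℝ y')
  have hebar : ∀ j, e₀ j hbar = 0 := by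
    intro j
    obtain ⟨φ, -, hφ⟩ := hqsum (EuclideanSpace.single j 1)
    have := hbarf φ _ hφ
    simpa [Pi.single_apply] using this
  have ht₀zero : ∀ i, t₀ i = 0 := by
    have hterm : ∀ i, t₀ i * ζ₀ i hbar ≤ 0 ∧ (t₀ i * ζ₀ i hbar = 0 → t₀ i = 0) := by
      intro i
      rcases (hfeas.2 i).lt_or_eq with hi | hi
      · have : t₀ i = 0 := tendsto_nhds_unique (htlim i)
          (tendsto_const_nhds.congr fun n => (hneg n i hi).symm)
        simp [this]
      · have hz := hbarg i hi _ (hζ₀ i)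
        exact ⟨mul_nonpos_of_nonneg_of_nonpos (ht₀ i).1 hz.le,
          fun h => (mul_eq_zero.1 h).resolve_right hz.ne⟩
    have hlim : -(0 * ‖hbar‖) ≤ ∑ j, |e₀ j hbar| + ∑ i, t₀ i * ζ₀ i hbar :=
      le_of_tendsto_of_tendsto' (hε.mul_const _).neg
        ((tendsto_finsetSum _ fun j _ => (helim j hbar).abs).add
          (tendsto_finsetSum _ fun i _ => (htlim i).mul (hζlim i hbar))) hlow
    simp only [hebar, abs_zero, Finset.sum_const_zero, zero_mul, neg_zero, zero_add] at hlim
    have hsum : ∑ i, t₀ i * ζ₀ i hbar = 0 :=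
      le_antisymm (Finset.sum_nonpos fun i _ => (hterm i).1) hlim
    intro i
    exact (hterm i).2 ((Finset.sum_eq_zero_iff_of_nonpos fun i _ => (hterm i).1).1 hsum i
      (Finset.mem_univ i))
  rcases Ultrafilter.eventually_or.1 (Eventually.of_forall (f := (𝒰 : Filter ℕ)) hcase) with H | H
  · have : (1 : ℝ) ≤ ∑ i, t₀ i :=
      ge_of_tendsto (tendsto_finsetSum _ fun i _ => htlim i) H
    simp only [ht₀zero, Finset.sum_const_zero] at this
    linarith
  · have hy₀ : ‖y₀‖ = 1 := tendsto_nhds_unique hylim.norm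
      (tendsto_const_nhds.congr' (H.mono fun n hn => hn.1.symm))
    have hzero : ∑ j, y₀ j • e₀ j = 0 := by
      ext h
      have hlim : |∑ j, y₀ j * e₀ j h + ∑ i, t₀ i * ζ₀ i h| ≤ 0 * ‖h‖ :=
        le_of_tendsto_of_tendsto
          ((tendsto_finsetSum _ fun j _ =>
            ((EuclideanSpace.proj j).continuous.tendsto y₀ |>.comp hylim).mul (helim j h)).add
            (tendsto_finsetSum _ fun i _ => (htlim i).mul (hζlim i h))).abs
          (hε.mul_const ‖h‖) (H.mono fun n hn => hn.2 h)
      simpa [ht₀zero] using hlim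
    obtain ⟨φ, hφ, hmem⟩ := hqsum y₀
    have := hκle φ (hφ.trans hy₀) _ hmem
    rw [hzero, norm_zero] at this
    linarith

end

/-! ### Exact penalization and the multiplier rule -/

section
variable {X : Type*} {l m : ℕ}

theorem penaltyFun_of_mem_feasibleSet {f : Fin l → X → ℝ} {g : Fin m → X → ℝ} {x : X}
    (hx : x ∈ feasibleSet f g) (u : X → ℝ) (c : ℝ) : penaltyFun u f g c x = u x := by
  simp [penaltyFun, hx.1, hx.2]

end

section
variable {X : Type*} [NormedAddCommGroup X] [NormedSpace ℝ X] {l m : ℕ}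

/-- Exactness of the penalty function: the Lipschitz constant of `u` divided by the constant of the
error bound is an exact penalty parameter. -/
theorem exists_isLocalMin_penaltyFun [CompleteSpace X] {u : X → ℝ} {f : Fin l → X → ℝ}
    {g : Fin m → X → ℝ} {xbar : X} (hopt : IsLocallyOptimal u f g xbar)
    (hu : ∃ K : NNReal, ∃ U ∈ 𝓝 xbar, LipschitzOnWith K u U)
    {Df : Fin l → X → DualPair X} (hDf : ∀ j, IsOSCQuasidifferentialMapAt (f j) xbar (Df j))
    {Dg : Fin m → X → DualPair X} (hDg : ∀ i, IsOSCQuasidifferentialMapAt (g i) xbar (Dg i))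
    (hMFCQ : QDMFCQ (scalarQuasidifferential fun j => Df j xbar) g (fun i => Dg i xbar) xbar) :
    ∃ cstar : ℝ, 0 ≤ cstar ∧ ∀ c, cstar ≤ c → IsLocalMin (penaltyFun u f g c) xbar := by
  obtain ⟨hfeas, hmin⟩ := hopt
  obtain ⟨K, U, hU, hK⟩ := hu
  obtain ⟨a, ha, hslope⟩ := exists_slope_bound hfeas hDf hDg hMFCQ
  have hcont : ∀ᶠ x in 𝓝 xbar, ContinuousAt (residual f g) x := by
    filter_upwards [eventually_all.2 fun j => (hDf j).eventually_continuousAt,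
      eventually_all.2 fun i => (hDg i).eventually_continuousAt] with x hf hg
    unfold residual
    fun_prop
  have herr := eventually_exists_zero_of_slope (residual_nonneg f g)
    (residual_eq_zero_iff.2 hfeas) hcont ha hslope
    (inter_mem hU (eventually_nhdsWithin_iff.1 hmin))
  refine ⟨K / a, by positivity, fun c hc => ?_⟩
  filter_upwards [herr, hU] with x ⟨z, ⟨hzU, hzmin⟩, hz0, hzx⟩ hxU
  have hz : u xbar ≤ u z := hzmin (residual_eq_zero_iff.1 hz0)
  have hLip : u z - u x ≤ K * ‖x - z‖ := by
    have := hK.dist_le_mul z hzU x hxU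
    rw [dist_comm z x, dist_eq_norm x z, Real.dist_eq] at this
    exact (le_abs_self _).trans this
  have hpen : residual f g x ≤ ∑ j, |f j x| + ∑ i, max (g i x) 0 :=
    add_le_add (sqrt_sum_sq_le_sum_abs _) le_rfl
  have h1 : K * ‖x - z‖ ≤ K / a * residual f g x := by
    rw [div_mul_eq_mul_div, le_div_iff₀ ha]
    calc K * ‖x - z‖ * a = K * (a * ‖x - z‖) := by ring
      _ ≤ K * residual f g x := by gcongr
  have h2 : K / a * residual f g x ≤ c * (∑ j, |f j x| + ∑ i, max (g i x) 0) :=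
    mul_le_mul hc hpen (residual_nonneg f g x) ((by positivity : (0 : ℝ) ≤ K / a).trans hc)
  rw [penaltyFun_of_mem_feasibleSet hfeas]
  unfold penaltyFun
  linarith

theorem exists_isQuasidifferentialAt_penaltyFun {u : X → ℝ} {f : Fin l → X → ℝ}
    {g : Fin m → X → ℝ} {x : X} (hx : x ∈ feasibleSet f g)
    (hu : ∃ D, IsQuasidifferentialAt u x D) (hf : ∀ j, ∃ D, IsQuasidifferentialAt (f j) x D)
    (hg : ∀ i, ∃ D, IsQuasidifferentialAt (g i) x D) {c : ℝ} (hc : 0 ≤ c) :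
    ∃ D, IsQuasidifferentialAt (penaltyFun u f g c) x D := by
  obtain ⟨D, hD⟩ := hu
  obtain ⟨E, hE⟩ := IsQuasidifferentialAt.exists_sum Finset.univ fun j =>
    (hf j).elim fun _ h => h.exists_abs_of_eq_zero (hx.1 j)
  obtain ⟨G, hG⟩ := IsQuasidifferentialAt.exists_sum Finset.univ fun i =>
    (hg i).elim fun _ h => h.exists_posPart_of_nonpos (hx.2 i)
  exact ⟨_, hD.add ((hE.add hG).const_mul hc)⟩

theorem HasDiniDirDerivAt.nonneg_of_isLocalMin {f : X → ℝ} {x h : X} {L : ℝ}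
    (hL : HasDiniDirDerivAt f x h L) (hmin : IsLocalMin f x) : 0 ≤ L := by
  simpa using hL.neg_mul_norm_le (a := 0) (hmin.mono fun y hy => by simpa using hy)

/-- The necessary optimality condition for an unconstrained local minimum. -/
theorem IsQuasidifferentialAt.zero_mem_of_isLocalMin {f : X → ℝ} {x : X} {D : DualPair X}
    (hD : IsQuasidifferentialAt f x D) (hmin : IsLocalMin f x) {w : StrongDual ℝ X}
    (hw : w ∈ D.super) : (0 : StrongDual ℝ X) ∈ D.sub + {w} := by
  refine (hD.sub_convexCompact.add (.singleton w)).zero_mem fun h => ?_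
  obtain ⟨v, hv, w', hw', -, hle, hL⟩ := hD.exists_extremal h
  exact ⟨v + w, add_mem_add hv rfl,
    (hL.nonneg_of_isLocalMin hmin).trans (add_le_add le_rfl (hle w hw))⟩

/-- The multiplier rule at a feasible local minimum of the penalty function; the multipliers are
bounded by the penalty parameter. -/
theorem exists_multipliers_of_isLocalMin_penaltyFun {u : X → ℝ} {f : Fin l → X → ℝ}
    {g : Fin m → X → ℝ} {x : X} (hx : x ∈ feasibleSet f g) {Du : DualPair X}
    (hDu : IsQuasidifferentialAt u x Du) {D : Fin l → DualPair X}
    (hD : ∀ j, IsQuasidifferentialAt (f j) x (D j)) {E : Fin m → DualPair X}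
    (hE : ∀ i, IsQuasidifferentialAt (g i) x (E i)) {c : ℝ} (hc : 0 ≤ c)
    (hmin : IsLocalMin (penaltyFun u f g c) x) {w₀ : StrongDual ℝ X} (hw₀ : w₀ ∈ Du.super)
    {v w : Fin l → StrongDual ℝ X} {z : Fin m → StrongDual ℝ X}
    (hv : ∀ j, v j ∈ (D j).sub) (hw : ∀ j, w j ∈ (D j).super) (hz : ∀ i, z i ∈ (E i).super) :
    ∃ (μlow μup : Fin l → ℝ) (lam : Fin m → ℝ),
      (∀ j, 0 ≤ μlow j) ∧ (∀ j, 0 ≤ μup j) ∧ (∀ i, 0 ≤ lam i) ∧ (∀ i, lam i * g i x = 0) ∧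
      (0 : StrongDual ℝ X) ∈ Du.sub + {w₀} - ∑ j, μlow j • ({v j} + (D j).super)
        + ∑ j, μup j • ((D j).sub + {w j}) + ∑ i, lam i • ((E i).sub + {z i}) ∧
      (∀ j, μlow j + μup j ≤ c) ∧ (∀ i, lam i ≤ c) := by
  choose G hGcc hGmem hG using fun i => (hE i).exists_posPart_majorant (hz i)
  have hA : ∀ j, IsWeakStarConvexCompact
      (convexJoin ℝ ((D j).sub + {w j}) (-({v j} + (D j).super))) := fun j =>
    ((hD j).sub_convexCompact.add (.singleton (w j))).convexJoin
      ((IsWeakStarConvexCompact.singleton (v j)).add (hD j).super_convexCompact).neg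
  have h0 : (0 : StrongDual ℝ X) ∈ (Du.sub + {w₀}) +
      c • (∑ j, convexJoin ℝ ((D j).sub + {w j}) (-({v j} + (D j).super)) + ∑ i, G i) := by
    refine IsWeakStarConvexCompact.zero_mem ((hDu.sub_convexCompact.add (.singleton w₀)).add
      (((IsWeakStarConvexCompact.sum _ hA).add (IsWeakStarConvexCompact.sum _ hGcc)).smul c))
      fun h => ?_
    obtain ⟨p, hp, q, hq, -, hqle, hpq⟩ := hDu.exists_extremal h
    choose v' hv' w' hw' _ _ hL using fun j => (hD j).exists_extremal h
    choose s hs hLs using fun j => (hD j).exists_abs_le (hv j) (hw j) (hL j)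
    choose L' hL' s' hs' hLs' using fun i => hG i h
    refine ⟨(p + w₀) + c • (∑ j, s j + ∑ i, s' i), add_mem_add (add_mem_add hp rfl)
      (smul_mem_smul_set (add_mem_add (finsetSum_mem_finsetSum _ _ _ fun j _ => hs j)
        (finsetSum_mem_finsetSum _ _ _ fun i _ => hs' i))), ?_⟩
    have hderiv : HasDiniDirDerivAt (penaltyFun u f g c) x h
        ((p h + q h) + c * (∑ j, |v' j h + w' j h| + ∑ i, L' i)) :=
      hpq.add (((HasDiniDirDerivAt.sum Finset.univ fun j =>
        (hL j).abs_of_eq_zero (hx.1 j)).add (HasDiniDirDerivAt.sum Finset.univ hL')).const_mul c)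
    refine (hderiv.nonneg_of_isLocalMin hmin).trans ?_
    simp only [add_apply, smul_apply, sum_apply, smul_eq_mul]
    have h1 : ∑ j, |v' j h + w' j h| ≤ ∑ j, s j h := Finset.sum_le_sum fun j _ => hLs j
    have h2 : ∑ i, L' i ≤ ∑ i, s' i h := Finset.sum_le_sum fun i _ => hLs' i
    gcongr
    exact hqle w₀ hw₀
  obtain ⟨p, hp, _, ⟨_, ⟨_, hsA, _, hsG, rfl⟩, rfl⟩, hsum⟩ := h0
  obtain ⟨s, hs, rfl⟩ := (mem_fintype_sum _ _).1 hsA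
  obtain ⟨s', hs', rfl⟩ := (mem_fintype_sum _ _).1 hsG
  choose a ha b hb hab using fun j => mem_convexJoin.1 (hs j)
  choose α β hα hβ hαβ hs_eq using hab
  choose t r hr ht0 ht1 _ htneg hs'_eq using fun i => hGmem i (s' i) (hs' i)
  refine ⟨fun j => c * β j, fun j => c * α j, fun i => c * t i, fun j => mul_nonneg hc (hβ j),
    fun j => mul_nonneg hc (hα j), fun i => mul_nonneg hc (ht0 i), fun i => ?_, ?_, fun j => ?_,
    fun i => mul_le_of_le_one_right hc (ht1 i)⟩
  · rcases (hx.2 i).lt_or_eq with hi | hi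
    · simp [htneg i hi]
    · simp [hi]
  · have hsum' : (p - ∑ j, (c * β j) • (-b j) + ∑ j, (c * α j) • a j)
        + ∑ i, (c * t i) • (r i + z i) = 0 := by
      rw [← hsum]
      simp only [← hs_eq, hs'_eq, smul_add, Finset.smul_sum, Finset.sum_add_distrib, smul_neg,
        Finset.sum_neg_distrib, smul_smul]
      abel
    rw [← hsum']
    refine add_mem_add (add_mem_add (Set.sub_mem_sub hp ?_) ?_) ?_
    · exact finsetSum_mem_finsetSum _ _ _ fun j _ => smul_mem_smul_set (mem_neg.1 (hb j))
    · exact finsetSum_mem_finsetSum _ _ _ fun j _ => smul_mem_smul_set (ha j)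
    · exact finsetSum_mem_finsetSum _ _ _ fun i _ =>
        smul_mem_smul_set (add_mem_add (hr i) rfl)
  · rw [← mul_add, add_comm, hαβ, mul_one]

end

end Quasidiff

theorem mainTheorem4 {X : Type*} [NormedAddCommGroup X] [NormedSpace ℝ X] [CompleteSpace X]
    {l m : ℕ} (u : X → ℝ) (f : Fin l → X → ℝ) (g : Fin m → X → ℝ) (xbar : X)
    (hopt : Quasidiff.IsLocallyOptimal u f g xbar)
    (Du : Quasidiff.DualPair X) (hDu : Quasidiff.IsQuasidifferentialAt u xbar Du)
    (hu : ∃ K : NNReal, ∃ U ∈ 𝓝 xbar, LipschitzOnWith K u U)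
    (Df : Fin l → X → Quasidiff.DualPair X)
    (hDf : ∀ j, Quasidiff.IsOSCQuasidifferentialMapAt (f j) xbar (Df j))
    (Dg : Fin m → X → Quasidiff.DualPair X)
    (hDg : ∀ i, Quasidiff.IsOSCQuasidifferentialMapAt (g i) xbar (Dg i))
    (hMFCQ : Quasidiff.QDMFCQ (Quasidiff.scalarQuasidifferential fun j => Df j xbar)
      g (fun i => Dg i xbar) xbar) :
    ∃ cstar : ℝ, 0 ≤ cstar ∧
      (∀ c : ℝ, cstar ≤ c →
        (∃ D, Quasidiff.IsQuasidifferentialAt (Quasidiff.penaltyFun u f g c) xbar D) ∧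
        ∀ D, Quasidiff.IsQuasidifferentialAt (Quasidiff.penaltyFun u f g c) xbar D →
          ∀ w ∈ D.super, (0 : StrongDual ℝ X) ∈ D.sub + {w}) ∧
      ∀ w₀ ∈ Du.super, ∀ v w : Fin l → StrongDual ℝ X, ∀ z : Fin m → StrongDual ℝ X,
        (∀ j, v j ∈ (Df j xbar).sub) → (∀ j, w j ∈ (Df j xbar).super) →
        (∀ i, z i ∈ (Dg i xbar).super) →
        ∃ (μlow μup : Fin l → ℝ) (lam : Fin m → ℝ),
          (∀ j, 0 ≤ μlow j) ∧ (∀ j, 0 ≤ μup j) ∧ (∀ i, 0 ≤ lam i) ∧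
          (∀ i, lam i * g i xbar = 0) ∧
          (0 : StrongDual ℝ X) ∈ Du.sub + {w₀}
            - ∑ j, μlow j • ({v j} + (Df j xbar).super)
            + ∑ j, μup j • ((Df j xbar).sub + {w j})
            + ∑ i, lam i • ((Dg i xbar).sub + {z i}) ∧
          (∀ j, μlow j + μup j ≤ cstar) ∧ (∀ i, lam i ≤ cstar) := by
  have hfeas := hopt.1
  have hDf' := fun j => (hDf j).isQuasidifferentialAt
  have hDg' := fun i => (hDg i).isQuasidifferentialAt
  obtain ⟨cstar, hc0, hmin⟩ := Quasidiff.exists_isLocalMin_penaltyFun hopt hu hDf hDg hMFCQ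
  refine ⟨cstar, hc0, fun c hc => ⟨?_, fun D hD w hw => ?_⟩, fun w₀ hw₀ v w z hv hw hz => ?_⟩
  · exact Quasidiff.exists_isQuasidifferentialAt_penaltyFun hfeas ⟨_, hDu⟩
      (fun j => ⟨_, hDf' j⟩) (fun i => ⟨_, hDg' i⟩) (hc0.trans hc)
  · exact hD.zero_mem_of_isLocalMin (hmin c hc) hw
  · exact Quasidiff.exists_multipliers_of_isLocalMin_penaltyFun hfeas hDu hDf' hDg' hc0
      (hmin cstar le_rfl) hw₀ hv hw hz
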